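/- **Setting.** Let $H$ be an infinite-dimensional separable real Hilbert space and $\Xi,\tilde U$ separable real Hilbert spaces, $A:D(A)\subset H\to H$ the generator of a $C_0$-semigroup on $H$, $L:=A^*$, $U\subset\tilde U$ compact, and $\gamma>0$. Let $Q\in\mathcal L(\Xi)$ be self-adjoint, positive and trace class, and let $b:H\times U\to H$, $\sigma:H\times U\to\mathcal L(\Xi;H)$, $l:H\times U\to\mathbb R$ be continuous and such that for some $C>0$, $m\ge 0$, some local moduli of continuity $\omega_R$ ($\omega_R(r)\to0$ as $r\to0^+$), and all $x,x'\in H$, $u\in U$, $$|b(x,u)-b(x',u)|+\|\sigma(x,u)-\sigma(x',u)\|\le C|x-x'|,\quad |b(x,u)|+\|\sigma(x,u)\|\le C(1+|x|),$$ $$|l(x,u)|\le C(1+|x|^m),\qquad |l(x,u)-l(x',u)|\le\omega_R(|x-x'|)\ \text{ if } |x|,|x'|\le R.$$ Let $S(H)$ be the space of bounded self-adjoint operators on $H$ with the operator norm, and set, for $x,p\in H$, $r\in\mathbb R$, $Z\in S(H)$, $u\in U$, $$F^{cv}(x,p,Z,u)=\langle p,b(x,u)\rangle+\tfrac12\mathrm{Tr}[\sigma(x,u)Q\sigma^*(x,u)Z]+l(x,u),\qquad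 F(x,r,p,Z)=-\gamma r+\inf_{u\in U}F^{cv}(x,p,Z,u),$$ $$(\mathcal F w)(x)=\langle LDw(x),x\rangle+F(x,w(x),Dw(x),D^2w(x)).$$ Let $v$ be a classical solution of the HJB equation $\mathcal Fv=0$ on $H$, that is, $v\in C^2(H)$, $Dv(x)\in D(L)$ for all $x$, $LDv\in C(H;H)$, and the equation holds at every $x\in H$. Assume that for all $(x,p,Z)\in H\times H\times S(H)$ the function $F^{cv}(x,p,Z,\cdot)$ has exactly one minimiser $\Psi(x,p,Z)$ on $U$, and put $\Phi(x)=\Psi(x,Dv(x),D^2v(x))$. Let $\{e_i\}_{i\ge1}\subset D(L)$ be an orthonormal basis of $H$ and $P_d$ the orthogonal projection onto $\mathrm{span}\{e_1,\dots,e_d\}$. For each $d\ge1$ let $\{\tilde f^{d,\theta}\}_{\theta\in\Theta_d}\subset C^2(\mathbb R^d)$ be a family of functions, and put $$v^{d,\theta}(x)=\tilde f^{d,\theta}(\langle x,e_1\rangle,\dots,\langle x,e_d\rangle),\qquad \Phi^{d,\theta}(x)=\Psi(x,Dv^{d,\theta}(x),D^2v^{d,\theta}(x)).$$ **Theorem.**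 (i) Suppose that for every $d\ge1$ the family $\{\tilde f^{d,\theta}\}_\theta$ is dense in $C^2(\mathbb R^d)$ for uniform convergence on compact sets of the function and its derivatives of order one and two. Let $K,K'\subset H$ be compact with $$\sup_{x\in K}|\langle L[Dv(x)-P_dDv(P_dx)],x\rangle|\to0\quad(d\to\infty).$$ Then for every $\epsilon>0$ there are $d\ge1$ and $\theta\in\Theta_d$ such that $Dv^{d,\theta}(x)\in D(L)$ for all $x\in H$, and for all $x\in K$, $h\in K'$, $$|v(x)-v^{d,\theta}(x)|<\epsilon,\quad |Dv(x)-Dv^{d,\theta}(x)|<\epsilon,\quad |[D^2v(x)-D^2v^{d,\theta}(x)]h|<\epsilon,$$ $$|\langle L[Dv(x)-Dv^{d,\theta}(x)],x\rangle|<\epsilon,\quad |(\mathcal Fv^{d,\theta})(x)|<\epsilon,\quad |\Phi(x)-\Phi^{d,\theta}(x)|_{\tilde U}<\epsilon.$$ (ii) Suppose that for every $d\ge1$, every finite Borel measure $\nu$ on $\mathbb R^d$, every $h\in C^2(\mathbb R^d)$ with finite $W^{2,4}(\mathbb R^d;\nu)$-norm and every $\delta>0$ there is $\theta\in\Theta_d$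 with $\|h-\tilde f^{d,\theta}\|_{W^{2,4}(\mathbb R^d;\nu)}<\delta$. Let $k\ge1$ be an exponent such that, for some constant $C$, $$|F(x,r,p,Z)-F(x,s,q,Y)|\le C(|r-s|+|p-q|+\|Z-Y\|)(1+|x|^k)$$ for all arguments (every $k\ge2$ is allowed, since under the assumptions above this estimate then holds automatically), and such that $|v(x)|+|Dv(x)|+\|D^2v(x)\|\le C(1+|x|^k)$ for all $x\in H$. Let $\mu,\mu'$ be Borel probability measures on $H$ with $\int_H|x|^{4k}\mu(dx)<\infty$ and $\int_H|h|^4\mu'(dh)<\infty$, and assume $$\int_H|\langle L[Dv(x)-P_dDv(P_dx)],x\rangle|^2\mu(dx)\to0\quad(d\to\infty).$$ Then for every $\epsilon>0$ there are $d\ge1$ and $\theta\in\Theta_d$ such that $Dv^{d,\theta}(x)\in D(L)$ for all $x\in H$, and $$\int_H|v-v^{d,\theta}|^4d\mu<\epsilon,\quad\int_H|Dv-Dv^{d,\theta}|^4d\mu<\epsilon,\quad\int_{H\times H}|[D^2v(x)-D^2v^{d,\theta}(x)]h|^4\mu(dx)\mu'(dh)<\epsilon,$$ $$\int_H|\langle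 L[Dv(x)-Dv^{d,\theta}(x)],x\rangle|^2\mu(dx)<\epsilon,\quad\int_H|\mathcal Fv^{d,\theta}|^2d\mu<\epsilon,\quad\|\Phi-\Phi^{d,\theta}\|^2_{L^2(H;\tilde U;\mu)}<\epsilon.$$ -/

import Mathlib

open MeasureTheory Filter Topology
open scoped ENNReal NNReal RealInnerProductSpace

noncomputable section

namespace HilbertHJB

section Calculus

variable {E : Type*} [NormedAddCommGroup E] [InnerProductSpace ℝ E] [CompleteSpace E]

/-- The Hessian `D²v(x)` as an operator on `E`: the Fréchet derivative of the Riesz gradient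
`Dv = gradient v`. For `v` of class `C²` it is the self-adjoint operator with
`⟪D²v(x) h₁, h₂⟫ = D²v(x)(h₁, h₂)`. -/
def hess (v : E → ℝ) (x : E) : E →L[ℝ] E := fderiv ℝ (gradient v) x

/-- The `w`-th power (up to equivalence) of the Sobolev norm `W^{2,w}(ν)`. -/
def sobolevEnergy [MeasurableSpace E] (w : ℕ) (ν : Measure E) (g : E → ℝ) : ℝ≥0∞ :=
  ∫⁻ y, (‖g y‖ₑ ^ w + ‖gradient g y‖ₑ ^ w + ‖hess g y‖ₑ ^ w) ∂ν

end Calculus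

section Semigroups

variable {E : Type*} [NormedAddCommGroup E] [NormedSpace ℝ E]

/-- Strongly continuous one-parameter semigroups of bounded operators. -/
structure IsC0Semigroup (S : ℝ≥0 → E →L[ℝ] E) : Prop where
  zero : S 0 = ContinuousLinearMap.id ℝ E
  add : ∀ s t, S (s + t) = (S s).comp (S t)
  tendsto_zero : ∀ x, Tendsto (fun t => S t x) (𝓝 0) (𝓝 x)

/-- `A` is the infinitesimal generator of `S`: `x ∈ D(A)` with `A x = y` if and only if
`(S(t) x - x) / t → y` as `t → 0⁺`. -/
def IsGenerator (S : ℝ≥0 → E →L[ℝ] E) (A : E →ₗ.[ℝ] E) : Prop :=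
  ∀ x y : E, (x, y) ∈ A.graph ↔
    Tendsto (fun t : ℝ≥0 => (t : ℝ)⁻¹ • (S t x - x)) (𝓝[≠] 0) (𝓝 y)

def GeneratesC0Semigroup (A : E →ₗ.[ℝ] E) : Prop :=
  ∃ S : ℝ≥0 → E →L[ℝ] E, IsC0Semigroup S ∧ IsGenerator S A

open Classical in
/-- The value `L y` of a partially defined operator for `y ∈ D(L)`, and `0` off `D(L)`. -/
def opApply (L : E →ₗ.[ℝ] E) (y : E) : E :=
  if h : y ∈ L.domain then L ⟨y, h⟩ else 0

end Semigroups

section Operators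

variable {E : Type*} [NormedAddCommGroup E] [InnerProductSpace ℝ E]

/-- Trace-class operators: `T x = ∑ᵢ ⟪aᵢ, x⟫ bᵢ` with `∑ᵢ ‖aᵢ‖ ‖bᵢ‖ < ∞`. -/
def IsTraceClass (T : E →L[ℝ] E) : Prop :=
  ∃ a b : ℕ → E, Summable (fun i => ‖a i‖ * ‖b i‖) ∧
    ∀ x, HasSum (fun i => ⟪a i, x⟫ • b i) (T x)

/-- The trace `∑ᵢ ⟪T eᵢ, eᵢ⟫`, computed in the orthonormal basis `e`; for a trace-class
operator it does not depend on `e`. -/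
def opTrace (e : HilbertBasis ℕ ℝ E) (T : E →L[ℝ] E) : ℝ := ∑' i, ⟪T (e i), e i⟫

/-- The coordinate operator `x ↦ (⟪x, e₁⟫, …, ⟪x, e_d⟫)`. -/
def coord (e : HilbertBasis ℕ ℝ E) (d : ℕ) (x : E) : EuclideanSpace ℝ (Fin d) :=
  WithLp.toLp 2 fun i => ⟪x, e i⟫

/-- The orthogonal projection `P_d` onto the span of the first `d` basis vectors. -/
def proj (e : HilbertBasis ℕ ℝ E) (d : ℕ) (x : E) : E :=
  ∑ i ∈ Finset.range d, ⟪x, e i⟫ • e i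

end Operators

section Networks

/-- A trainable family `f̃^{d,θ} : ℝ^d → ℝ`, `θ ∈ Θ d`, is dense in `C²(ℝ^d)` for the `C²`
compact-open topology, in every dimension `d ≥ 1`. -/
def UniversalOnCompacts {Θ : ℕ → Type*}
    (f : ∀ d, Θ d → EuclideanSpace ℝ (Fin d) → ℝ) : Prop :=
  ∀ d, 1 ≤ d → ∀ h : EuclideanSpace ℝ (Fin d) → ℝ, ContDiff ℝ 2 h →
    ∀ K : Set (EuclideanSpace ℝ (Fin d)), IsCompact K → ∀ ε : ℝ, 0 < ε → ∃ θ : Θ d, ∀ y ∈ K,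
      |h y - f d θ y| < ε ∧ ‖gradient (fun z => h z - f d θ z) y‖ < ε ∧
        ‖hess (fun z => h z - f d θ z) y‖ < ε

/-- For every dimension `d ≥ 1` and every finite Borel measure `ν` on `ℝ^d`, every `C²` function
of finite `W^{2,w}(ν)` norm is approximated by the family in that norm. -/
def UniversalInSobolev {Θ : ℕ → Type*} (w : ℕ)
    (f : ∀ d, Θ d → EuclideanSpace ℝ (Fin d) → ℝ) : Prop :=
  ∀ d, 1 ≤ d → ∀ ν : Measure (EuclideanSpace ℝ (Fin d)), IsFiniteMeasure ν →
    ∀ h : EuclideanSpace ℝ (Fin d) → ℝ, ContDiff ℝ 2 h → sobolevEnergy w ν h < ∞ →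
      ∀ ε : ℝ, 0 < ε → ∃ θ : Θ d,
        sobolevEnergy w ν (fun z => h z - f d θ z) < ENNReal.ofReal ε

/-- The scalar Hilbert--Galerkin neural operator `v^{d,θ} = f̃^{d,θ} ∘ coord_d`. -/
def hgno {E : Type*} [NormedAddCommGroup E] [InnerProductSpace ℝ E] {Θ : ℕ → Type*}
    (e : HilbertBasis ℕ ℝ E) (f : ∀ d, Θ d → EuclideanSpace ℝ (Fin d) → ℝ)
    (d : ℕ) (θ : Θ d) (x : E) : ℝ :=
  f d θ (coord e d x)

end Networks

section Control

variable {H Ξ Ut : Type*}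
  [NormedAddCommGroup H] [InnerProductSpace ℝ H] [CompleteSpace H]
  [NormedAddCommGroup Ξ] [InnerProductSpace ℝ Ξ] [CompleteSpace Ξ]
  [NormedAddCommGroup Ut] [InnerProductSpace ℝ Ut]

/-- The coefficients of the controlled equation `dX = [A X + b(X,u)] dt + σ(X,u) dW^Q` and the
running cost `l`, with controls in `U`. -/
structure Coefficients (H Ξ : Type*) {Ut : Type*}
    [NormedAddCommGroup H] [InnerProductSpace ℝ H]
    [NormedAddCommGroup Ξ] [InnerProductSpace ℝ Ξ] (U : Set Ut) where
  Q : Ξ →L[ℝ] Ξ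
  b : H → U → H
  σ : H → U → Ξ →L[ℝ] H
  l : H → U → ℝ

/-- The standing assumptions on the coefficients. In the last one, `ω R` is a local modulus of
continuity of `l(·, u)`, uniform in `u`. -/
structure Coefficients.Regular {U : Set Ut} (c : Coefficients H Ξ U) : Prop where
  Q_pos : c.Q.IsPositive
  Q_trace : IsTraceClass c.Q
  b_cont : Continuous fun z : H × U => c.b z.1 z.2
  σ_cont : Continuous fun z : H × U => c.σ z.1 z.2
  l_cont : Continuous fun z : H × U => c.l z.1 z.2
  b_bound : ∃ C : ℝ, ∀ x x' u, ‖c.b x u - c.b x' u‖ ≤ C * ‖x' - x‖ ∧ ‖c.b x u‖ ≤ C * (1 + ‖x‖)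
  σ_bound : ∃ C : ℝ, ∀ x x' u, ‖c.σ x u - c.σ x' u‖ ≤ C * ‖x' - x‖ ∧ ‖c.σ x u‖ ≤ C * (1 + ‖x‖)
  l_bound : ∃ C m : ℝ, 0 ≤ m ∧ ∀ x u, |c.l x u| ≤ C * (1 + ‖x‖ ^ m)
  l_modulus : ∃ ω : ℝ → ℝ → ℝ, ∀ R : ℝ, 0 < R →
    Tendsto (ω R) (𝓝[≥] 0) (𝓝 0) ∧
    ∀ x x' : H, ‖x‖ ≤ R → ‖x'‖ ≤ R → ∀ u, |c.l x u - c.l x' u| ≤ ω R ‖x' - x‖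

/-- The current-value Hamiltonian
`F^cv(x,p,Z,u) = ⟪p, b(x,u)⟫ + ½ Tr[σ(x,u) Q σ(x,u)* Z] + l(x,u)`. -/
def Fcv {U : Set Ut} (c : Coefficients H Ξ U) (e : HilbertBasis ℕ ℝ H)
    (x p : H) (Z : H →L[ℝ] H) (u : U) : ℝ :=
  ⟪p, c.b x u⟫
    + 1 / 2 * opTrace e
        ((c.σ x u).comp (c.Q.comp ((ContinuousLinearMap.adjoint (c.σ x u)).comp Z)))
    + c.l x u

/-- `F(x,r,p,Z) = -γ r + inf_{u ∈ U} F^cv(x,p,Z,u)`. -/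
def hamiltonian {U : Set Ut} (c : Coefficients H Ξ U) (e : HilbertBasis ℕ ℝ H) (γ : ℝ)
    (x : H) (r : ℝ) (p : H) (Z : H →L[ℝ] H) : ℝ :=
  -γ * r + ⨅ u : U, Fcv c e x p Z u

/-- The set of minimisers of `F^cv(x,p,Z,·)` over `U`. -/
def argminFcv {U : Set Ut} (c : Coefficients H Ξ U) (e : HilbertBasis ℕ ℝ H)
    (x p : H) (Z : H →L[ℝ] H) : Set U :=
  {u | ∀ w : U, Fcv c e x p Z u ≤ Fcv c e x p Z w}

/-- `u(x) = Ψ(x, Dv(x), D²v(x))`, the feedback induced by `v` and an argmin map `Ψ`. -/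
def feedback {U : Set Ut} (Ψ : H → H → (H →L[ℝ] H) → U) (v : H → ℝ) (x : H) : Ut :=
  Ψ x (gradient v x) (hess v x)

/-- The structure condition on `F` with growth exponent `k` in the state variable; `F` is regarded
on self-adjoint operators. -/
def GrowthLipschitz (F : H → ℝ → H → (H →L[ℝ] H) → ℝ) (k : ℝ) : Prop :=
  ∃ C : ℝ, ∀ (x : H) (r s : ℝ) (p q : H) (Z Y : H →L[ℝ] H),
    IsSelfAdjoint Z → IsSelfAdjoint Y →
      |F x r p Z - F x s q Y| ≤ C * (|r - s| + ‖p - q‖ + ‖Z - Y‖) * (1 + ‖x‖ ^ k)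

/-- The residual `⟪L Dv(x), x⟫ + F(x, v(x), Dv(x), D²v(x))`; meaningful where
`Dv(x) ∈ D(L)`. -/
def residual (L : H →ₗ.[ℝ] H) (F : H → ℝ → H → (H →L[ℝ] H) → ℝ) (v : H → ℝ) (x : H) : ℝ :=
  ⟪opApply L (gradient v x), x⟫ + F x (v x) (gradient v x) (hess v x)

/-- Classical solutions on the whole space: `v ∈ C²(H)`, `Dv(x) ∈ D(L)`, `L Dv ∈ C(H;H)`, and
the equation holds everywhere. -/
structure IsClassicalSolution (L : H →ₗ.[ℝ] H) (F : H → ℝ → H → (H →L[ℝ] H) → ℝ)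
    (v : H → ℝ) : Prop where
  contDiff : ContDiff ℝ 2 v
  mem_domain : ∀ x, gradient v x ∈ L.domain
  continuous_L : Continuous fun x => opApply L (gradient v x)
  equation : ∀ x, residual L F v x = 0

/-- `⟪L[Dv(x) - P_d Dv(P_d x)], x⟫`. -/
def consistencyError (L : H →ₗ.[ℝ] H) (e : HilbertBasis ℕ ℝ H) (v : H → ℝ) (d : ℕ) (x : H) : ℝ :=
  ⟪opApply L (gradient v x - proj e d (gradient v (proj e d x))), x⟫

end Control

end HilbertHJB

end

/-! The candidate limit is the Galerkin function `v ∘ P_d`, which depends on `d` coordinates only,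
so that a finite-dimensional universality theorem can replace it by a member of the family. Two
difficulties remain: `L` is unbounded, and `D²(v ∘ P_d)(x) = P_d D²v(P_d x) P_d` converges to
`D²v(x)` in general only strongly, not in operator norm.

For the first, every `e i` lies in `D(L)`, so `L` is bounded on the span of the first `d` of them,
with a constant that may blow up with `d`. Since `d` is fixed before `θ`, the `C²` error in `ℝ^d`
can be made small relative to this constant; `galerkinError` carries the weight. What is left of the
`L` term is the consistency error, which tends to zero by hypothesis
(`abs_inner_opApply_gradient_sub_le`).

For the second, bounded strong convergence is enough. Expanding the trace-class operator `Q` in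
rank-one terms writes `Tr[σ Q σ* Z]` as a series whose terms see `Z` on single vectors and which is
dominated uniformly for bounded `Z` (`opTrace_diffusion_eq_tsum`, `tendsto_Fcv`). Compactness of `U`
and uniqueness of the minimiser then make the argmin, and with it the Hamiltonian, continuous in the
same sense (`tendsto_argmin`, `tendsto_hamiltonian`). The residual is handled by subtracting the
equation solved by `v`.

In (i), convergence along `d → ∞` and `y → x` in `K` jointly, at each point of `K`, gives uniform
convergence on `K` by compactness. In (ii), errors with summable fourth-power integrals are chosen;
their sum is an integrable dominating function and forces almost everywhere convergence, so
dominated convergence applies, with the growth bounds on `v` and the Lipschitz estimate on `F`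
supplying the majorants. -/

noncomputable section

namespace HilbertHJB

/-! ### Traces of operators given by rank-one series. -/

section Trace

variable {E : Type*} [NormedAddCommGroup E] [InnerProductSpace ℝ E]

/-- Cauchy–Schwarz and Bessel on finite partial sums. The bound on absolute values is what permits
exchanging the two series in `opTrace_eq_tsum`. -/
theorem summable_abs_inner_mul_inner (e : HilbertBasis ℕ ℝ E) (α β : E) :
    Summable (fun i => |⟪α, e i⟫ * ⟪β, e i⟫|) ∧
      ∑' i, |⟪α, e i⟫ * ⟪β, e i⟫| ≤ ‖α‖ * ‖β‖ := by
  have key : ∀ s : Finset ℕ, ∑ i ∈ s, |⟪α, e i⟫ * ⟪β, e i⟫| ≤ ‖α‖ * ‖β‖ := by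
    intro s
    have bessel : ∀ γ : E, √(∑ i ∈ s, |⟪γ, e i⟫| ^ 2) ≤ ‖γ‖ := by
      intro γ
      refine Real.sqrt_le_iff.2 ⟨norm_nonneg _, ?_⟩
      have := e.orthonormal.sum_inner_products_le γ (s := s)
      simpa [real_inner_comm] using this
    calc ∑ i ∈ s, |⟪α, e i⟫ * ⟪β, e i⟫| = ∑ i ∈ s, |⟪α, e i⟫| * |⟪β, e i⟫| := by
          simp only [abs_mul]
      _ ≤ √(∑ i ∈ s, |⟪α, e i⟫| ^ 2) * √(∑ i ∈ s, |⟪β, e i⟫| ^ 2) :=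
          Real.sum_mul_le_sqrt_mul_sqrt _ _ _
      _ ≤ ‖α‖ * ‖β‖ := by gcongr <;> exact bessel _
  exact ⟨summable_of_sum_le (fun _ => abs_nonneg _) key,
    Real.tsum_le_of_sum_le (fun _ => abs_nonneg _) key⟩

/-- The trace of `∑ⱼ ⟪αⱼ, ·⟫ βⱼ` is `∑ⱼ ⟪αⱼ, βⱼ⟫`. -/
theorem opTrace_eq_tsum (e : HilbertBasis ℕ ℝ E) {α β : ℕ → E}
    (hs : Summable fun j => ‖α j‖ * ‖β j‖) {T : E →L[ℝ] E}
    (hT : ∀ x, HasSum (fun j => ⟪α j, x⟫ • β j) (T x)) :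
    opTrace e T = ∑' j, ⟪α j, β j⟫ := by
  have h1 : ∀ i, ⟪T (e i), e i⟫ = ∑' j, ⟪α j, e i⟫ * ⟪β j, e i⟫ := by
    intro i
    have := (hT (e i)).mapL (innerSL ℝ (e i))
    simp only [innerSL_apply_apply, inner_smul_right] at this
    rw [real_inner_comm, ← this.tsum_eq]
    simp only [real_inner_comm]
  have h2 : ∀ j, ∑' i, ⟪α j, e i⟫ * ⟪β j, e i⟫ = ⟪α j, β j⟫ := by
    intro j
    rw [← e.tsum_inner_mul_inner (α j) (β j)]
    simp only [real_inner_comm]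
  -- Absolute summability of the double series: for fixed `j` the sum over the basis is at most `‖α
  -- j‖ * ‖β j‖`, which is summable in `j`.
  have h3 : Summable (Function.uncurry fun j i => ⟪α j, e i⟫ * ⟪β j, e i⟫) := by
    rw [← summable_abs_iff, summable_prod_of_nonneg (fun _ => abs_nonneg _)]
    refine ⟨fun j => (summable_abs_inner_mul_inner e (α j) (β j)).1, ?_⟩
    exact hs.of_nonneg_of_le (fun j => tsum_nonneg fun i => abs_nonneg _)
      fun j => (summable_abs_inner_mul_inner e (α j) (β j)).2
  calc opTrace e T = ∑' i, ∑' j, ⟪α j, e i⟫ * ⟪β j, e i⟫ := by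
        simp only [opTrace, h1]
    _ = ∑' j, ∑' i, ⟪α j, e i⟫ * ⟪β j, e i⟫ := h3.tsum_comm
    _ = ∑' j, ⟪α j, β j⟫ := by simp only [h2]

end Trace

/-! ### Continuity of the Hamiltonian and of its minimiser. -/

section Hamiltonian

variable {H Ξ Ut : Type*}
  [NormedAddCommGroup H] [InnerProductSpace ℝ H] [NormedAddCommGroup Ξ] [InnerProductSpace ℝ Ξ]

theorem norm_apply_mul_norm_apply_le (S : Ξ →L[ℝ] H) (α β : Ξ) :
    ‖S α‖ * ‖S β‖ ≤ ‖S‖ ^ 2 * (‖α‖ * ‖β‖) := by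
  calc ‖S α‖ * ‖S β‖ ≤ (‖S‖ * ‖α‖) * (‖S‖ * ‖β‖) := by
        gcongr <;> exact S.le_opNorm _
    _ = ‖S‖ ^ 2 * (‖α‖ * ‖β‖) := by ring

theorem abs_inner_apply_le (S : Ξ →L[ℝ] H) (Z : H →L[ℝ] H) (α β : Ξ) :
    |⟪S α, Z (S β)⟫| ≤ ‖S‖ ^ 2 * ‖Z‖ * (‖α‖ * ‖β‖) := by
  calc |⟪S α, Z (S β)⟫| ≤ ‖S α‖ * ‖Z (S β)‖ := abs_real_inner_le_norm _ _
    _ ≤ ‖S α‖ * (‖Z‖ * ‖S β‖) := by gcongr; exact Z.le_opNorm _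
    _ = ‖Z‖ * (‖S α‖ * ‖S β‖) := by ring
    _ ≤ ‖Z‖ * (‖S‖ ^ 2 * (‖α‖ * ‖β‖)) := by
        exact mul_le_mul_of_nonneg_left (norm_apply_mul_norm_apply_le S α β) (norm_nonneg _)
    _ = ‖S‖ ^ 2 * ‖Z‖ * (‖α‖ * ‖β‖) := by ring

theorem tendsto_clm_apply {J : Type*} {l : Filter J} {Z : J → H →L[ℝ] H} {η : J → H} {h : H}
    {Z₀ : H →L[ℝ] H} (hZ : Tendsto Z l (𝓝 Z₀)) (hη : Tendsto η l (𝓝 h)) :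
    Tendsto (fun j => Z j (η j)) l (𝓝 (Z₀ h)) :=
  (isBoundedBilinearMap_apply.continuous.tendsto (Z₀, h)).comp (hZ.prodMk_nhds hη)

/-- Split `Z j (η j) = Z j (η j - h) + Z j h`: the norm bound controls the first term, strong
convergence the second. -/
theorem tendsto_apply_of_strong {J : Type*} {l : Filter J} {Z : J → H →L[ℝ] H} {η : J → H}
    {h : H} {Z₀ : H →L[ℝ] H} (hZ : ∀ h, Tendsto (fun j => Z j h) l (𝓝 (Z₀ h))) {M : ℝ}
    (hM : ∀ᶠ j in l, ‖Z j‖ ≤ M) (hη : Tendsto η l (𝓝 h)) :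
    Tendsto (fun j => Z j (η j)) l (𝓝 (Z₀ h)) := by
  have h0 : Tendsto (fun j => Z j (η j - h)) l (𝓝 0) := by
    have h1 : Tendsto (fun j => M * ‖η j - h‖) l (𝓝 0) := by
      simpa using (tendsto_iff_norm_sub_tendsto_zero.1 hη).const_mul M
    refine squeeze_zero_norm' (hM.mono fun j hj => ?_) h1
    exact ((Z j).le_opNorm _).trans (by gcongr)
  simpa using h0.add (hZ h)

variable [CompleteSpace H] [CompleteSpace Ξ]

/-- The rank-one expansion of `Q` turns into one of `S Q S* Z` with vectors `Z* S αⱼ` and `S βⱼ`. In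
the resulting series `Z` acts on fixed vectors, so strong convergence of `Z` passes to each term. -/
theorem opTrace_diffusion_eq_tsum (e : HilbertBasis ℕ ℝ H) {Q : Ξ →L[ℝ] Ξ} {α β : ℕ → Ξ}
    (hs : Summable fun j => ‖α j‖ * ‖β j‖) (hQ : ∀ x, HasSum (fun j => ⟪α j, x⟫ • β j) (Q x))
    (S : Ξ →L[ℝ] H) (Z : H →L[ℝ] H) :
    opTrace e (S.comp (Q.comp ((ContinuousLinearMap.adjoint S).comp Z)))
      = ∑' j, ⟪S (α j), Z (S (β j))⟫ := by
  rw [opTrace_eq_tsum e (α := fun j => ContinuousLinearMap.adjoint Z (S (α j)))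
    (β := fun j => S (β j))]
  · simp only [ContinuousLinearMap.adjoint_inner_left]
  · refine (hs.mul_left (‖ContinuousLinearMap.adjoint Z‖ * ‖S‖ ^ 2)).of_nonneg_of_le
      (fun j => by positivity) fun j => ?_
    calc ‖ContinuousLinearMap.adjoint Z (S (α j))‖ * ‖S (β j)‖
        ≤ (‖ContinuousLinearMap.adjoint Z‖ * ‖S (α j)‖) * ‖S (β j)‖ := by
          gcongr; exact ContinuousLinearMap.le_opNorm _ _
      _ = ‖ContinuousLinearMap.adjoint Z‖ * (‖S (α j)‖ * ‖S (β j)‖) := by ring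
      _ ≤ ‖ContinuousLinearMap.adjoint Z‖ * (‖S‖ ^ 2 * (‖α j‖ * ‖β j‖)) := by
          exact mul_le_mul_of_nonneg_left (norm_apply_mul_norm_apply_le S _ _) (norm_nonneg _)
      _ = _ := by ring
  · intro x
    have := (hQ (ContinuousLinearMap.adjoint S (Z x))).mapL S
    simpa only [ContinuousLinearMap.adjoint_inner_left, ContinuousLinearMap.adjoint_inner_right,
      map_smul, ContinuousLinearMap.comp_apply] using this

variable {U : Set Ut} {c : Coefficients H Ξ U} {e : HilbertBasis ℕ ℝ H}

theorem argmin_apply_le {Ψ : H → H → (H →L[ℝ] H) → U}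
    (hΨ : ∀ (x p : H) (Z : H →L[ℝ] H), IsSelfAdjoint Z → argminFcv c e x p Z = {Ψ x p Z})
    (x p : H) {Z : H →L[ℝ] H} (hZ : IsSelfAdjoint Z) (w : U) :
    Fcv c e x p Z (Ψ x p Z) ≤ Fcv c e x p Z w := by
  have : Ψ x p Z ∈ argminFcv c e x p Z := by rw [hΨ x p Z hZ]; rfl
  exact this w

/-- The infimum is attained. Attainment also provides the lower bound without which a real `⨅` would
take its default value. -/
theorem hamiltonian_eq {Ψ : H → H → (H →L[ℝ] H) → U}
    (hΨ : ∀ (x p : H) (Z : H →L[ℝ] H), IsSelfAdjoint Z → argminFcv c e x p Z = {Ψ x p Z})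
    (γ : ℝ) (x : H) (r : ℝ) (p : H) {Z : H →L[ℝ] H} (hZ : IsSelfAdjoint Z) :
    hamiltonian c e γ x r p Z = -γ * r + Fcv c e x p Z (Ψ x p Z) := by
  have hle := argmin_apply_le hΨ x p hZ
  have : Nonempty U := ⟨Ψ x p Z⟩
  rw [hamiltonian, le_antisymm (ciInf_le ⟨_, by rintro _ ⟨w, rfl⟩; exact hle w⟩ _)
    (le_ciInf hle)]

variable [NormedAddCommGroup Ut]

/-- Dominated convergence for the trace series, with the summable majorant `‖αⱼ‖ ‖βⱼ‖` up to a
constant; only bounded strong convergence of `Z j` is needed. -/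
theorem tendsto_Fcv (hc : c.Regular) {J : Type*} {l : Filter J} {ξ p : J → H}
    {Z : J → H →L[ℝ] H} {u : J → U} {x p₀ : H} {Z₀ : H →L[ℝ] H} {u₀ : U}
    (hξ : Tendsto ξ l (𝓝 x)) (hp : Tendsto p l (𝓝 p₀))
    (hZ : ∀ h, Tendsto (fun j => Z j h) l (𝓝 (Z₀ h))) {M : ℝ} (hM : ∀ᶠ j in l, ‖Z j‖ ≤ M)
    (hu : Tendsto u l (𝓝 u₀)) :
    Tendsto (fun j => Fcv c e (ξ j) (p j) (Z j) (u j)) l (𝓝 (Fcv c e x p₀ Z₀ u₀)) := by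
  obtain ⟨α, β, hs, hQ⟩ := hc.Q_trace
  have hxu : Tendsto (fun j => (ξ j, u j)) l (𝓝 (x, u₀)) := hξ.prodMk_nhds hu
  have hb : Tendsto (fun j => c.b (ξ j) (u j)) l (𝓝 (c.b x u₀)) :=
    (hc.b_cont.tendsto (x, u₀)).comp hxu
  have hσ : Tendsto (fun j => c.σ (ξ j) (u j)) l (𝓝 (c.σ x u₀)) :=
    (hc.σ_cont.tendsto (x, u₀)).comp hxu
  have hl : Tendsto (fun j => c.l (ξ j) (u j)) l (𝓝 (c.l x u₀)) :=
    (hc.l_cont.tendsto (x, u₀)).comp hxu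
  have hσa : ∀ y, Tendsto (fun j => c.σ (ξ j) (u j) y) l (𝓝 (c.σ x u₀ y)) := fun y =>
    ((ContinuousLinearMap.apply ℝ H y).continuous.tendsto _).comp hσ
  simp only [Fcv, opTrace_diffusion_eq_tsum e hs hQ]
  refine ((hp.inner hb).add (Tendsto.const_mul _ ?_)).add hl
  refine tendsto_tsum_of_dominated_convergence
    (hs.mul_left ((‖c.σ x u₀‖ + 1) ^ 2 * M)) (fun i => ?_) ?_
  · exact (hσa _).inner (tendsto_apply_of_strong hZ hM (hσa _))
  · have h1 : ∀ᶠ j in l, ‖c.σ (ξ j) (u j)‖ ≤ ‖c.σ x u₀‖ + 1 :=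
      hσ.norm.eventually_le_const (by linarith)
    filter_upwards [h1, hM] with j h1 h2 i
    refine (abs_inner_apply_le _ _ _ _).trans ?_
    gcongr

/-- The argmin map is continuous along self-adjoint operators for the strong operator topology
on bounded sets. -/
theorem tendsto_argmin (hc : c.Regular) (hU : IsCompact U) {Ψ : H → H → (H →L[ℝ] H) → U}
    (hΨ : ∀ (x p : H) (Z : H →L[ℝ] H), IsSelfAdjoint Z → argminFcv c e x p Z = {Ψ x p Z})
    {J : Type*} {l : Filter J} {ξ p : J → H} {Z : J → H →L[ℝ] H} {x p₀ : H} {Z₀ : H →L[ℝ] H}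
    (hξ : Tendsto ξ l (𝓝 x)) (hp : Tendsto p l (𝓝 p₀))
    (hZ : ∀ h, Tendsto (fun j => Z j h) l (𝓝 (Z₀ h))) {M : ℝ} (hM : ∀ᶠ j in l, ‖Z j‖ ≤ M)
    (hsa : ∀ j, IsSelfAdjoint (Z j)) (hsa₀ : IsSelfAdjoint Z₀) :
    Tendsto (fun j => Ψ (ξ j) (p j) (Z j)) l (𝓝 (Ψ x p₀ Z₀)) := by
  have : CompactSpace U := isCompact_iff_compactSpace.1 hU
  -- Along any ultrafilter the minimisers converge to some `u` by compactness of `U`. The minimising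
  -- inequality passes to the limit, so `u` is a minimiser of the limit problem, and uniqueness
  -- identifies it.
  rw [tendsto_iff_ultrafilter]
  intro g hg
  obtain ⟨u, -, hu⟩ := isCompact_univ.ultrafilter_le_nhds
    (g.map fun j => Ψ (ξ j) (p j) (Z j)) (by simp)
  have hu : Tendsto (fun j => Ψ (ξ j) (p j) (Z j)) g (𝓝 u) := hu
  have hmem : u ∈ argminFcv c e x p₀ Z₀ := by
    intro w
    refine le_of_tendsto_of_tendsto' (b := (g : Filter J))
      (tendsto_Fcv hc (hξ.mono_left hg) (hp.mono_left hg) (fun h => (hZ h).mono_left hg)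
        (hg hM) hu)
      (tendsto_Fcv hc (hξ.mono_left hg) (hp.mono_left hg) (fun h => (hZ h).mono_left hg)
        (hg hM) (tendsto_const_nhds (x := w)))
      fun j => argmin_apply_le hΨ _ _ (hsa j) w
  rw [hΨ x p₀ Z₀ hsa₀] at hmem
  rw [← Set.mem_singleton_iff.1 hmem]
  exact hu

theorem tendsto_hamiltonian (hc : c.Regular) (hU : IsCompact U) {Ψ : H → H → (H →L[ℝ] H) → U}
    (hΨ : ∀ (x p : H) (Z : H →L[ℝ] H), IsSelfAdjoint Z → argminFcv c e x p Z = {Ψ x p Z})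
    (γ : ℝ) {J : Type*} {l : Filter J} {ξ p : J → H} {r : J → ℝ} {Z : J → H →L[ℝ] H}
    {x p₀ : H} {r₀ : ℝ} {Z₀ : H →L[ℝ] H}
    (hξ : Tendsto ξ l (𝓝 x)) (hr : Tendsto r l (𝓝 r₀)) (hp : Tendsto p l (𝓝 p₀))
    (hZ : ∀ h, Tendsto (fun j => Z j h) l (𝓝 (Z₀ h))) {M : ℝ} (hM : ∀ᶠ j in l, ‖Z j‖ ≤ M)
    (hsa : ∀ j, IsSelfAdjoint (Z j)) (hsa₀ : IsSelfAdjoint Z₀) :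
    Tendsto (fun j => hamiltonian c e γ (ξ j) (r j) (p j) (Z j)) l
      (𝓝 (hamiltonian c e γ x r₀ p₀ Z₀)) := by
  simp only [hamiltonian_eq hΨ γ _ _ _ (hsa _), hamiltonian_eq hΨ γ _ _ _ hsa₀]
  exact (hr.const_mul _).add (tendsto_Fcv hc hξ hp hZ hM
    (tendsto_argmin hc hU hΨ hξ hp hZ hM hsa hsa₀))

/-- An infimum of functions with a common Lipschitz bound inherits that bound. The exponent two
comes from the trace term, which is quadratic in `σ`, and `σ` grows linearly. -/
theorem growthLipschitz_of_two_le (hc : c.Regular) {Ψ : H → H → (H →L[ℝ] H) → U}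
    (hΨ : ∀ (x p : H) (Z : H →L[ℝ] H), IsSelfAdjoint Z → argminFcv c e x p Z = {Ψ x p Z})
    (γ : ℝ) {k : ℝ} (hk : 2 ≤ k) : GrowthLipschitz (hamiltonian c e γ) k := by
  obtain ⟨α, β, hs, hQ⟩ := hc.Q_trace
  obtain ⟨B, hB⟩ := hc.b_bound
  obtain ⟨S, hS⟩ := hc.σ_bound
  set N := ∑' j, ‖α j‖ * ‖β j‖ with hN
  have hN0 : 0 ≤ N := tsum_nonneg fun j => by positivity
  -- If `‖x‖ ≤ 1` the left side is at most 4; otherwise `1 + ‖x‖ ≤ 2‖x‖` and `‖x‖² ≤ ‖x‖ ^ k`.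
  have hpow : ∀ x : H, (1 + ‖x‖) ^ 2 ≤ 4 * (1 + ‖x‖ ^ k) := by
    intro x
    rcases le_total ‖x‖ 1 with h | h
    · have : 0 ≤ ‖x‖ ^ k := by positivity
      nlinarith [norm_nonneg x]
    · have : ‖x‖ ^ 2 ≤ ‖x‖ ^ k := by
        rw [← Real.rpow_natCast]
        exact Real.rpow_le_rpow_of_exponent_le h (by exact_mod_cast hk)
      nlinarith
  have hlin : ∀ x : H, 1 + ‖x‖ ≤ 4 * (1 + ‖x‖ ^ k) := fun x =>
    le_trans (by nlinarith [norm_nonneg x]) (hpow x)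
  have hFcv : ∀ (x p q : H) (Z Y : H →L[ℝ] H) (u : U),
      Fcv c e x p Z u - Fcv c e x q Y u ≤
        (|B| + S ^ 2 * N) * 4 * (‖p - q‖ + ‖Z - Y‖) * (1 + ‖x‖ ^ k) := by
    intro x p q Z Y u
    have h1 : ⟪p, c.b x u⟫ - ⟪q, c.b x u⟫ ≤ ‖p - q‖ * (|B| * (1 + ‖x‖)) := by
      rw [← inner_sub_left]
      refine (real_inner_le_norm _ _).trans ?_
      gcongr
      exact ((hB x x u).2).trans (by gcongr; exact le_abs_self B)
    have hsum : ∀ W : H →L[ℝ] H,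
        Summable fun j => ⟪c.σ x u (α j), W (c.σ x u (β j))⟫ := fun W =>
      Summable.of_norm_bounded (hs.mul_left (‖c.σ x u‖ ^ 2 * ‖W‖))
        fun j => abs_inner_apply_le _ _ _ _
    have h2 : ∑' j, ⟪c.σ x u (α j), Z (c.σ x u (β j))⟫
        - ∑' j, ⟪c.σ x u (α j), Y (c.σ x u (β j))⟫ ≤ ‖Z - Y‖ * ((S * (1 + ‖x‖)) ^ 2 * N) := by
      rw [← (hsum Z).tsum_sub (hsum Y), hN, ← tsum_mul_left, ← tsum_mul_left]
      refine Summable.tsum_le_tsum (fun j => ?_) ((hsum Z).sub (hsum Y))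
        ((hs.mul_left _).mul_left _)
      rw [← inner_sub_right, ← sub_apply]
      refine (le_abs_self _).trans ((abs_inner_apply_le _ _ _ _).trans ?_)
      have := (hS x x u).2
      calc ‖c.σ x u‖ ^ 2 * ‖Z - Y‖ * (‖α j‖ * ‖β j‖)
          ≤ (S * (1 + ‖x‖)) ^ 2 * ‖Z - Y‖ * (‖α j‖ * ‖β j‖) := by gcongr
        _ = _ := by ring
    simp only [Fcv, opTrace_diffusion_eq_tsum e hs hQ]
    have h3 : ‖p - q‖ * (|B| * (1 + ‖x‖)) ≤ ‖p - q‖ * (|B| * (4 * (1 + ‖x‖ ^ k))) := by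
      gcongr; exact hlin x
    have h4 : ‖Z - Y‖ * ((S * (1 + ‖x‖)) ^ 2 * N) ≤
        ‖Z - Y‖ * (S ^ 2 * (4 * (1 + ‖x‖ ^ k)) * N) := by
      rw [mul_pow]; gcongr; exact hpow x
    have h5 : 0 ≤ ‖Z - Y‖ * (S ^ 2 * (4 * (1 + ‖x‖ ^ k)) * N) := by positivity
    have h6 : 0 ≤ ‖p - q‖ * (S ^ 2 * (4 * (1 + ‖x‖ ^ k)) * N) := by positivity
    have h7 : 0 ≤ ‖Z - Y‖ * (|B| * (4 * (1 + ‖x‖ ^ k))) := by positivity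
    linarith
  have hone : ∀ (x : H) (r s : ℝ) (p q : H) (Z Y : H →L[ℝ] H), IsSelfAdjoint Z →
      IsSelfAdjoint Y → hamiltonian c e γ x r p Z - hamiltonian c e γ x s q Y ≤
        (|γ| + (|B| + S ^ 2 * N) * 4) * (|r - s| + ‖p - q‖ + ‖Z - Y‖) * (1 + ‖x‖ ^ k) := by
    intro x r s p q Z Y hZ hY
    rw [hamiltonian_eq hΨ γ x r p hZ, hamiltonian_eq hΨ γ x s q hY]
    -- The minimiser for `(q, Y)` is used as a competitor for `(p, Z)`, which gives a one-sided
    -- bound; exchanging the roles gives the other side.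
    have h1 := argmin_apply_le hΨ x p hZ (Ψ x q Y)
    have h2 := hFcv x p q Z Y (Ψ x q Y)
    have hx : 0 ≤ ‖x‖ ^ k := by positivity
    have h3 : -γ * r - -γ * s ≤ |γ| * |r - s| := by
      rw [← mul_sub, ← abs_neg γ, ← abs_mul]; exact le_abs_self _
    have h4 : |γ| * |r - s| ≤ |γ| * (|r - s| + ‖p - q‖ + ‖Z - Y‖) * (1 + ‖x‖ ^ k) := by
      have : |r - s| ≤ (|r - s| + ‖p - q‖ + ‖Z - Y‖) * (1 + ‖x‖ ^ k) := by
        nlinarith [norm_nonneg (p - q), norm_nonneg (Z - Y), abs_nonneg (r - s),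
          mul_nonneg (norm_nonneg (p - q)) hx, mul_nonneg (norm_nonneg (Z - Y)) hx,
          mul_nonneg (abs_nonneg (r - s)) hx]
      rw [mul_assoc]; gcongr
    have h5 : 0 ≤ (|B| + S ^ 2 * N) * 4 * |r - s| * (1 + ‖x‖ ^ k) := by positivity
    linarith
  refine ⟨_, fun x r s p q Z Y hZ hY => abs_sub_le_iff.2 ⟨hone x r s p q Z Y hZ hY, ?_⟩⟩
  have := hone x s r q p Y Z hY hZ
  rwa [abs_sub_comm, norm_sub_rev q, norm_sub_rev Y] at this

end Hamiltonian

/-! ### Gradients and Hessians under linear substitutions. -/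

section Calculus

variable {E F : Type*} [NormedAddCommGroup E] [InnerProductSpace ℝ E] [CompleteSpace E]
  [NormedAddCommGroup F] [InnerProductSpace ℝ F] [CompleteSpace F]

theorem gradient_comp_clm (T : E →L[ℝ] F) {g : F → ℝ} (hg : Differentiable ℝ g) (x : E) :
    gradient (fun z => g (T z)) x = ContinuousLinearMap.adjoint T (gradient g (T x)) := by
  refine HasGradientAt.gradient (hasGradientAt_iff_hasFDerivAt.2 ?_)
  have h := ((hg (T x)).hasFDerivAt).comp x T.hasFDerivAt
  have heq : InnerProductSpace.toDual ℝ E (ContinuousLinearMap.adjoint T (gradient g (T x)))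
      = (fderiv ℝ g (T x)).comp T := by
    ext y
    simp [ContinuousLinearMap.adjoint_inner_left, inner_gradient_left]
  rw [heq]
  exact h

theorem contDiff_gradient {g : F → ℝ} (hg : ContDiff ℝ 2 g) : ContDiff ℝ 1 (gradient g) :=
  (InnerProductSpace.toDual ℝ F).symm.contDiff.comp (hg.fderiv_right (m := 1) (by norm_num))

theorem continuous_gradient {g : F → ℝ} (hg : ContDiff ℝ 2 g) : Continuous (gradient g) :=
  (contDiff_gradient hg).continuous

theorem continuous_hess {g : F → ℝ} (hg : ContDiff ℝ 2 g) : Continuous (hess g) :=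
  (contDiff_gradient hg).continuous_fderiv (by norm_num)

theorem differentiable_gradient {g : F → ℝ} (hg : ContDiff ℝ 2 g) :
    Differentiable ℝ (gradient g) :=
  (contDiff_gradient hg).differentiable (by norm_num)

theorem hess_comp_clm (T : E →L[ℝ] F) {g : F → ℝ} (hg : ContDiff ℝ 2 g) (x : E) :
    hess (fun z => g (T z)) x
      = (ContinuousLinearMap.adjoint T).comp ((hess g (T x)).comp T) := by
  have h : gradient (fun z => g (T z)) =
      fun z => ContinuousLinearMap.adjoint T (gradient g (T z)) :=
    funext fun z => gradient_comp_clm T (hg.differentiable (by norm_num)) z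
  rw [hess, h]
  exact ((ContinuousLinearMap.adjoint T).hasFDerivAt.comp x
    (((differentiable_gradient hg) (T x)).hasFDerivAt.comp x T.hasFDerivAt)).fderiv

theorem gradient_sub {g k : F → ℝ} (hg : Differentiable ℝ g) (hk : Differentiable ℝ k) (x : F) :
    gradient (fun z => g z - k z) x = gradient g x - gradient k x := by
  rw [gradient, fderiv_fun_sub (hg x) (hk x), map_sub]; rfl

theorem hess_sub {g k : F → ℝ} (hg : ContDiff ℝ 2 g) (hk : ContDiff ℝ 2 k) (x : F) :
    hess (fun z => g z - k z) x = hess g x - hess k x := by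
  have h : gradient (fun z => g z - k z) = fun z => gradient g z - gradient k z :=
    funext fun z => gradient_sub (hg.differentiable (by norm_num))
      (hk.differentiable (by norm_num)) z
  rw [hess, h]
  exact fderiv_fun_sub (differentiable_gradient hg x) (differentiable_gradient hk x)

/-- Symmetry of the second Fréchet derivative, carried through the Riesz isomorphism. It is needed
because unique minimisers are assumed for self-adjoint `Z` only. -/
theorem isSelfAdjoint_hess {g : F → ℝ} (hg : ContDiff ℝ 2 g) (x : F) :
    IsSelfAdjoint (hess g x) := by
  rw [ContinuousLinearMap.isSelfAdjoint_iff_isSymmetric]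
  have hs : IsSymmSndFDerivAt ℝ g x := hg.contDiffAt.isSymmSndFDerivAt (by simp)
  have key : ∀ y z, ⟪hess g x y, z⟫ = fderiv ℝ (fderiv ℝ g) x y z := by
    intro y z
    have h : fderiv ℝ g = fun w => InnerProductSpace.toDual ℝ F (gradient g w) := by
      ext w; simp [gradient]
    have h2 : HasFDerivAt (fderiv ℝ g) ((InnerProductSpace.toDualMap ℝ F).toContinuousLinearMap.comp
        (hess g x)) x := by
      rw [h]
      exact (InnerProductSpace.toDualMap ℝ F).toContinuousLinearMap.hasFDerivAt.comp x
        (differentiable_gradient hg x).hasFDerivAt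
    rw [h2.fderiv]
    simp
  intro y z
  change ⟪hess g x y, z⟫ = ⟪y, hess g x z⟫
  rw [key, real_inner_comm, key]
  exact hs.eq _ _

end Calculus

/-! ### Linearity of the totalised operator on its domain. -/

section Operators

variable {E : Type*} [NormedAddCommGroup E] [NormedSpace ℝ E]

theorem opApply_of_mem {L : E →ₗ.[ℝ] E} {y : E} (h : y ∈ L.domain) : opApply L y = L ⟨y, h⟩ :=
  dif_pos h

theorem opApply_add {L : E →ₗ.[ℝ] E} {y z : E} (hy : y ∈ L.domain) (hz : z ∈ L.domain) :
    opApply L (y + z) = opApply L y + opApply L z := by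
  rw [opApply_of_mem hy, opApply_of_mem hz, opApply_of_mem (L.domain.add_mem hy hz), ← L.map_add]
  rfl

theorem opApply_sub {L : E →ₗ.[ℝ] E} {y z : E} (hy : y ∈ L.domain) (hz : z ∈ L.domain) :
    opApply L (y - z) = opApply L y - opApply L z := by
  rw [opApply_of_mem hy, opApply_of_mem hz, opApply_of_mem (L.domain.sub_mem hy hz), ← L.map_sub]
  rfl

theorem opApply_smul {L : E →ₗ.[ℝ] E} (a : ℝ) {y : E} (hy : y ∈ L.domain) :
    opApply L (a • y) = a • opApply L y := by
  rw [opApply_of_mem hy, opApply_of_mem (L.domain.smul_mem a hy), ← L.map_smul]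
  rfl

theorem opApply_sum {L : E →ₗ.[ℝ] E} {ι : Type*} (s : Finset ι) {y : ι → E}
    (hy : ∀ i, y i ∈ L.domain) : opApply L (∑ i ∈ s, y i) = ∑ i ∈ s, opApply L (y i) := by
  classical
  induction s using Finset.induction_on with
  | empty => simpa using opApply_smul (L := L) 0 L.domain.zero_mem
  | insert i s hi ih =>
    rw [Finset.sum_insert hi, Finset.sum_insert hi,
      opApply_add (hy i) (L.domain.sum_mem fun j _ => hy j), ih]

end Operators

/-! ### Coordinates, embeddings and projections. -/

section Coordinates

variable {E : Type*} [NormedAddCommGroup E] [InnerProductSpace ℝ E]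

/-- `coord e d` as a bounded operator. -/
def coordL (e : HilbertBasis ℕ ℝ E) (d : ℕ) : E →L[ℝ] EuclideanSpace ℝ (Fin d) :=
  ((EuclideanSpace.equiv (Fin d) ℝ).symm : (Fin d → ℝ) →L[ℝ] EuclideanSpace ℝ (Fin d)).comp
    (ContinuousLinearMap.pi fun i : Fin d => innerSL ℝ (e i))

theorem coordL_apply (e : HilbertBasis ℕ ℝ E) (d : ℕ) (x : E) : coordL e d x = coord e d x := by
  ext i
  simp [coordL, coord, real_inner_comm]

theorem coord_apply (e : HilbertBasis ℕ ℝ E) (d : ℕ) (x : E) (i : Fin d) :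
    coord e d x i = ⟪x, e i⟫ := rfl

theorem norm_coord_le (e : HilbertBasis ℕ ℝ E) (d : ℕ) (x : E) : ‖coord e d x‖ ≤ ‖x‖ := by
  refine le_of_sq_le_sq ?_ (norm_nonneg _)
  rw [EuclideanSpace.norm_sq_eq]
  have h := (e.orthonormal.comp (fun i : Fin d => (i : ℕ)) Fin.val_injective).sum_inner_products_le
    x (s := Finset.univ)
  simpa [coord_apply, real_inner_comm] using h

theorem norm_coordL_le (e : HilbertBasis ℕ ℝ E) (d : ℕ) : ‖coordL e d‖ ≤ 1 :=
  ContinuousLinearMap.opNorm_le_bound _ zero_le_one fun x => by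
    rw [coordL_apply, one_mul]; exact norm_coord_le e d x

/-- A bound for the norm of `L` on the span of the first `d` basis vectors. -/
def galerkinBound (L : E →ₗ.[ℝ] E) (e : HilbertBasis ℕ ℝ E) (d : ℕ) : ℝ :=
  ∑ i : Fin d, ‖opApply L (e i)‖

theorem galerkinBound_nonneg (L : E →ₗ.[ℝ] E) (e : HilbertBasis ℕ ℝ E) (d : ℕ) :
    0 ≤ galerkinBound L e d := Finset.sum_nonneg fun _ _ => norm_nonneg _

variable [CompleteSpace E]

/-- The embedding `y ↦ ∑ᵢ yᵢ eᵢ` of `ℝ^d`. -/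
def embed (e : HilbertBasis ℕ ℝ E) (d : ℕ) : EuclideanSpace ℝ (Fin d) →L[ℝ] E :=
  ContinuousLinearMap.adjoint (coordL e d)

theorem adjoint_embed (e : HilbertBasis ℕ ℝ E) (d : ℕ) :
    ContinuousLinearMap.adjoint (embed e d) = coordL e d :=
  ContinuousLinearMap.adjoint_adjoint _

theorem embed_apply (e : HilbertBasis ℕ ℝ E) (d : ℕ) (y : EuclideanSpace ℝ (Fin d)) :
    embed e d y = ∑ i : Fin d, y i • e i := by
  refine ext_inner_right ℝ fun x => ?_
  rw [embed, ContinuousLinearMap.adjoint_inner_left, coordL_apply, sum_inner, PiLp.inner_apply]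
  simp [coord_apply, inner_smul_left, real_inner_comm, mul_comm]

theorem norm_embed_le (e : HilbertBasis ℕ ℝ E) (d : ℕ) : ‖embed e d‖ ≤ 1 := by
  rw [embed, LinearIsometryEquiv.norm_map]; exact norm_coordL_le e d

theorem norm_embed_apply_le (e : HilbertBasis ℕ ℝ E) (d : ℕ) (y : EuclideanSpace ℝ (Fin d)) :
    ‖embed e d y‖ ≤ ‖y‖ := by
  simpa using (embed e d).le_of_opNorm_le (norm_embed_le e d) y

theorem embed_coord (e : HilbertBasis ℕ ℝ E) (d : ℕ) (x : E) :
    embed e d (coord e d x) = proj e d x := by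
  rw [embed_apply, proj, Finset.sum_range]; rfl

theorem norm_proj_le (e : HilbertBasis ℕ ℝ E) (d : ℕ) (x : E) : ‖proj e d x‖ ≤ ‖x‖ := by
  rw [← embed_coord]
  exact (norm_embed_apply_le e d _).trans (norm_coord_le e d x)

theorem proj_sub (e : HilbertBasis ℕ ℝ E) (d : ℕ) (x y : E) :
    proj e d (x - y) = proj e d x - proj e d y := by
  simp only [← embed_coord, ← coordL_apply, map_sub]

/-- The projections are contractions, so moving the argument costs at most `‖ξ j - x‖`; at the fixed
point `x` this is the basis expansion. -/
theorem tendsto_proj (e : HilbertBasis ℕ ℝ E) {J : Type*} {l : Filter J} {n : J → ℕ} {ξ : J → E}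
    {x : E} (hn : Tendsto n l atTop) (hξ : Tendsto ξ l (𝓝 x)) :
    Tendsto (fun j => proj e (n j) (ξ j)) l (𝓝 x) := by
  have h1 : Tendsto (fun d => proj e d x) atTop (𝓝 x) := by
    have := (e.hasSum_repr x).tendsto_sum_nat
    simpa only [proj, e.repr_apply_apply, real_inner_comm] using this
  have h2 : Tendsto (fun j => proj e (n j) (ξ j - x)) l (𝓝 0) :=
    squeeze_zero_norm (fun j => norm_proj_le e _ _) (tendsto_iff_norm_sub_tendsto_zero.1 hξ)
  simpa [proj_sub] using h2.add (h1.comp hn)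

theorem embed_mem_domain {L : E →ₗ.[ℝ] E} {e : HilbertBasis ℕ ℝ E} (he : ∀ i, e i ∈ L.domain)
    (d : ℕ) (y : EuclideanSpace ℝ (Fin d)) : embed e d y ∈ L.domain := by
  rw [embed_apply]
  exact L.domain.sum_mem fun i _ => L.domain.smul_mem _ (he i)

theorem opApply_embed {L : E →ₗ.[ℝ] E} {e : HilbertBasis ℕ ℝ E} (he : ∀ i, e i ∈ L.domain)
    (d : ℕ) (y : EuclideanSpace ℝ (Fin d)) :
    opApply L (embed e d y) = ∑ i : Fin d, y i • opApply L (e i) := by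
  rw [embed_apply, opApply_sum _ fun i : Fin d => L.domain.smul_mem (y i) (he i)]
  exact Finset.sum_congr rfl fun i _ => opApply_smul _ (he i)

/-- On the span of finitely many vectors of `D(L)` the unbounded `L` is bounded. The constant
depends on `d` in an uncontrolled way, which the weight in `galerkinError` absorbs. -/
theorem norm_opApply_embed_le {L : E →ₗ.[ℝ] E} {e : HilbertBasis ℕ ℝ E}
    (he : ∀ i, e i ∈ L.domain) (d : ℕ) (y : EuclideanSpace ℝ (Fin d)) :
    ‖opApply L (embed e d y)‖ ≤ galerkinBound L e d * ‖y‖ := by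
  rw [opApply_embed he, galerkinBound, Finset.sum_mul]
  refine (norm_sum_le _ _).trans (Finset.sum_le_sum fun i _ => ?_)
  rw [norm_smul, mul_comm]
  gcongr
  exact PiLp.norm_apply_le y i

end Coordinates

/-! ### Galerkin approximation of `v` and of its derivatives. -/

section Galerkin

variable {H : Type*} [NormedAddCommGroup H] [InnerProductSpace ℝ H]

theorem contDiff_comp_coord (e : HilbertBasis ℕ ℝ H) (d : ℕ)
    {g : EuclideanSpace ℝ (Fin d) → ℝ} (hg : ContDiff ℝ 2 g) :
    ContDiff ℝ 2 fun x => g (coord e d x) := by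
  simp only [← coordL_apply]
  exact hg.comp (coordL e d).contDiff

theorem continuous_coord (e : HilbertBasis ℕ ℝ H) (d : ℕ) : Continuous (coord e d) :=
  (coordL e d).continuous.congr (coordL_apply e d)

variable [CompleteSpace H]

theorem contDiff_comp_embed (e : HilbertBasis ℕ ℝ H) {v : H → ℝ} (hv : ContDiff ℝ 2 v) (d : ℕ) :
    ContDiff ℝ 2 fun y => v (embed e d y) :=
  hv.comp (embed e d).contDiff

theorem gradient_comp_coord (e : HilbertBasis ℕ ℝ H) (d : ℕ)
    {g : EuclideanSpace ℝ (Fin d) → ℝ} (hg : ContDiff ℝ 2 g) (x : H) :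
    gradient (fun x => g (coord e d x)) x = embed e d (gradient g (coord e d x)) := by
  simp only [← coordL_apply]
  exact gradient_comp_clm (coordL e d) (hg.differentiable (by norm_num)) x

theorem hess_comp_coord (e : HilbertBasis ℕ ℝ H) (d : ℕ)
    {g : EuclideanSpace ℝ (Fin d) → ℝ} (hg : ContDiff ℝ 2 g) (x : H) :
    hess (fun x => g (coord e d x)) x
      = (embed e d).comp ((hess g (coord e d x)).comp (coordL e d)) := by
  simp only [← coordL_apply]
  exact hess_comp_clm (coordL e d) hg x

theorem gradient_comp_embed (e : HilbertBasis ℕ ℝ H) {v : H → ℝ} (hv : ContDiff ℝ 2 v) (d : ℕ)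
    (y : EuclideanSpace ℝ (Fin d)) :
    gradient (fun y => v (embed e d y)) y = coord e d (gradient v (embed e d y)) := by
  rw [gradient_comp_clm (embed e d) (hv.differentiable (by norm_num)), adjoint_embed, coordL_apply]

theorem hess_comp_embed (e : HilbertBasis ℕ ℝ H) {v : H → ℝ} (hv : ContDiff ℝ 2 v) (d : ℕ)
    (y : EuclideanSpace ℝ (Fin d)) :
    hess (fun y => v (embed e d y)) y
      = (coordL e d).comp ((hess v (embed e d y)).comp (embed e d)) := by
  rw [hess_comp_clm (embed e d) hv, adjoint_embed]

theorem norm_hess_comp_embed_le (e : HilbertBasis ℕ ℝ H) {v : H → ℝ} (hv : ContDiff ℝ 2 v) (d : ℕ)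
    (y : EuclideanSpace ℝ (Fin d)) :
    ‖hess (fun y => v (embed e d y)) y‖ ≤ ‖hess v (embed e d y)‖ := by
  rw [hess_comp_embed e hv]
  calc _ ≤ ‖coordL e d‖ * (‖hess v (embed e d y)‖ * ‖embed e d‖) :=
        (ContinuousLinearMap.opNorm_comp_le _ _).trans (by
          gcongr; exact ContinuousLinearMap.opNorm_comp_le _ _)
    _ ≤ 1 * (‖hess v (embed e d y)‖ * 1) := by
        gcongr
        exacts [norm_coordL_le e d, norm_embed_le e d]
    _ = _ := by ring

/-- The Galerkin approximation `x ↦ v (P_d x)`. -/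
def galerkin (e : HilbertBasis ℕ ℝ H) (v : H → ℝ) (d : ℕ) (x : H) : ℝ := v (proj e d x)

theorem galerkin_eq (e : HilbertBasis ℕ ℝ H) (v : H → ℝ) (d : ℕ) :
    galerkin e v d = fun x => (fun y => v (embed e d y)) (coord e d x) :=
  funext fun x => by simp only [galerkin, embed_coord]

theorem gradient_galerkin (e : HilbertBasis ℕ ℝ H) {v : H → ℝ} (hv : ContDiff ℝ 2 v) (d : ℕ)
    (x : H) : gradient (galerkin e v d) x = proj e d (gradient v (proj e d x)) := by
  rw [galerkin_eq, gradient_comp_coord e d (contDiff_comp_embed e hv d),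
    gradient_comp_embed e hv, embed_coord, embed_coord]

/-- The Hessian is sandwiched between two projections; since these tend to the identity only
strongly, so in general does the Hessian. -/
theorem hess_galerkin_apply (e : HilbertBasis ℕ ℝ H) {v : H → ℝ} (hv : ContDiff ℝ 2 v) (d : ℕ)
    (x h : H) :
    hess (galerkin e v d) x h = proj e d (hess v (proj e d x) (proj e d h)) := by
  rw [galerkin_eq, hess_comp_coord e d (contDiff_comp_embed e hv d), hess_comp_embed e hv]
  simp only [ContinuousLinearMap.comp_apply, coordL_apply, embed_coord]

theorem norm_hess_galerkin_le (e : HilbertBasis ℕ ℝ H) {v : H → ℝ} (hv : ContDiff ℝ 2 v) (d : ℕ)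
    (x : H) : ‖hess (galerkin e v d) x‖ ≤ ‖hess v (proj e d x)‖ := by
  refine ContinuousLinearMap.opNorm_le_bound _ (norm_nonneg _) fun h => ?_
  rw [hess_galerkin_apply e hv]
  refine (norm_proj_le e d _).trans ((ContinuousLinearMap.le_opNorm _ _).trans ?_)
  gcongr
  exact norm_proj_le e d h

/-- The pointwise `C²` distance, at the coordinates of `x`, between `v` restricted to the first `d`
coordinates and `g`, weighted by the size of `L` on these coordinates. -/
def galerkinError (L : H →ₗ.[ℝ] H) (e : HilbertBasis ℕ ℝ H) (v : H → ℝ) (d : ℕ)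
    (g : EuclideanSpace ℝ (Fin d) → ℝ) (x : H) : ℝ :=
  (1 + galerkinBound L e d) *
    max |v (embed e d (coord e d x)) - g (coord e d x)|
      (max ‖gradient (fun y => v (embed e d y) - g y) (coord e d x)‖
        ‖hess (fun y => v (embed e d y) - g y) (coord e d x)‖)

variable {L : H →ₗ.[ℝ] H} {e : HilbertBasis ℕ ℝ H} {v : H → ℝ} {d : ℕ}
  {g : EuclideanSpace ℝ (Fin d) → ℝ}

theorem galerkinError_nonneg (x : H) : 0 ≤ galerkinError L e v d g x :=
  mul_nonneg (by linarith [galerkinBound_nonneg L e d])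
    (le_max_of_le_left (abs_nonneg _))

theorem le_galerkinError {a : ℝ} {x : H}
    (h : a ≤ max |v (embed e d (coord e d x)) - g (coord e d x)|
      (max ‖gradient (fun y => v (embed e d y) - g y) (coord e d x)‖
        ‖hess (fun y => v (embed e d y) - g y) (coord e d x)‖)) :
    a ≤ galerkinError L e v d g x :=
  h.trans (le_mul_of_one_le_left (le_max_of_le_left (abs_nonneg _))
    (by linarith [galerkinBound_nonneg L e d]))

theorem continuous_galerkinError (hv : ContDiff ℝ 2 v) (hg : ContDiff ℝ 2 g) :
    Continuous (galerkinError L e v d g) := by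
  have h2 : ContDiff ℝ 2 fun y => v (embed e d y) - g y := (contDiff_comp_embed e hv d).sub hg
  have hc := continuous_coord e d
  refine continuous_const.mul (Continuous.max ?_ (Continuous.max ?_ ?_))
  · exact (h2.continuous.comp hc).abs
  · exact ((continuous_gradient h2).comp hc).norm
  · exact ((continuous_hess h2).comp hc).norm

theorem abs_galerkin_sub_le (x : H) :
    |galerkin e v d x - g (coord e d x)| ≤ galerkinError L e v d g x :=
  le_galerkinError (by rw [galerkin, ← embed_coord]; exact le_max_left _ _)

theorem gradient_galerkin_sub (hv : ContDiff ℝ 2 v) (hg : ContDiff ℝ 2 g) (x : H) :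
    gradient (galerkin e v d) x - gradient (fun x => g (coord e d x)) x
      = embed e d (gradient (fun y => v (embed e d y) - g y) (coord e d x)) := by
  have h1 := contDiff_comp_embed e hv d
  rw [galerkin_eq, gradient_comp_coord e d h1, gradient_comp_coord e d hg,
    gradient_sub (h1.differentiable (by norm_num)) (hg.differentiable (by norm_num)), map_sub]

theorem norm_gradient_galerkin_sub_le (hv : ContDiff ℝ 2 v) (hg : ContDiff ℝ 2 g) (x : H) :
    ‖gradient (galerkin e v d) x - gradient (fun x => g (coord e d x)) x‖
      ≤ galerkinError L e v d g x := by
  rw [gradient_galerkin_sub hv hg]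
  exact le_galerkinError ((norm_embed_apply_le e d _).trans
    (le_max_of_le_right (le_max_left _ _)))

theorem norm_hess_galerkin_sub_le (hv : ContDiff ℝ 2 v) (hg : ContDiff ℝ 2 g) (x : H) :
    ‖hess (galerkin e v d) x - hess (fun x => g (coord e d x)) x‖
      ≤ galerkinError L e v d g x := by
  have h1 := contDiff_comp_embed e hv d
  have h2 : hess (galerkin e v d) x - hess (fun x => g (coord e d x)) x
      = (embed e d).comp ((hess (fun y => v (embed e d y) - g y) (coord e d x)).comp
          (coordL e d)) := by
    rw [galerkin_eq, hess_comp_coord e d h1, hess_comp_coord e d hg, hess_sub h1 hg]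
    ext h
    simp
  refine le_galerkinError (le_max_of_le_right (le_max_of_le_right ?_))
  rw [h2]
  calc _ ≤ ‖embed e d‖ * (‖hess (fun y => v (embed e d y) - g y) (coord e d x)‖ * ‖coordL e d‖) :=
        (ContinuousLinearMap.opNorm_comp_le _ _).trans (by
          gcongr; exact ContinuousLinearMap.opNorm_comp_le _ _)
    _ ≤ 1 * (‖hess (fun y => v (embed e d y) - g y) (coord e d x)‖ * 1) := by
        gcongr
        exacts [norm_embed_le e d, norm_coordL_le e d]
    _ = _ := by ring

theorem gradient_comp_coord_mem_domain (he : ∀ i, e i ∈ L.domain) (hg : ContDiff ℝ 2 g) (x : H) :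
    gradient (fun x => g (coord e d x)) x ∈ L.domain := by
  rw [gradient_comp_coord e d hg]; exact embed_mem_domain he d _

/-- Insert `P_d Dv(P_d x)`. One part is the consistency error; the other is `L` applied to an
embedded vector of `ℝ^d`, bounded by the weighted error. All vectors lie in `D(L)`, so `L` may be
split. -/
theorem abs_inner_opApply_gradient_sub_le (hv : ContDiff ℝ 2 v) (hg : ContDiff ℝ 2 g)
    (he : ∀ i, e i ∈ L.domain) {x : H} (hx : gradient v x ∈ L.domain) :
    |⟪opApply L (gradient v x - gradient (fun x => g (coord e d x)) x), x⟫|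
      ≤ |consistencyError L e v d x| + galerkinError L e v d g x * ‖x‖ := by
  set q := gradient (fun y => v (embed e d y) - g y) (coord e d x) with hq
  have h1 : gradient v x - gradient (fun x => g (coord e d x)) x
      = (gradient v x - proj e d (gradient v (proj e d x))) + embed e d q := by
    rw [hq, ← gradient_galerkin_sub hv hg, gradient_galerkin e hv]; abel
  have h2 : proj e d (gradient v (proj e d x)) ∈ L.domain := by
    rw [← embed_coord]; exact embed_mem_domain he d _
  rw [h1, opApply_add (L.domain.sub_mem hx h2) (embed_mem_domain he d _), inner_add_left]
  refine (abs_add_le _ _).trans (add_le_add le_rfl ?_)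
  refine (abs_real_inner_le_norm _ _).trans ?_
  gcongr
  refine (norm_opApply_embed_le he d q).trans ?_
  have h0 := galerkinBound_nonneg L e d
  rw [galerkinError]
  gcongr
  · linarith
  · exact le_max_of_le_right (le_max_left _ _)

section Limits

variable {J : Type*} {l : Filter J} {n : J → ℕ} {ξ : J → H} {x : H}

/-- The limits are taken along an arbitrary filter with a moving point `ξ j`, so as to serve both
uniform convergence on compacts (`ξ` varying in `K`) and almost everywhere convergence (`ξ`
constant). -/
theorem tendsto_galerkin (hv : ContDiff ℝ 2 v) (hn : Tendsto n l atTop) (hξ : Tendsto ξ l (𝓝 x)) :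
    Tendsto (fun j => galerkin e v (n j) (ξ j)) l (𝓝 (v x)) :=
  (hv.continuous.tendsto x).comp (tendsto_proj e hn hξ)

theorem tendsto_gradient_galerkin (hv : ContDiff ℝ 2 v) (hn : Tendsto n l atTop)
    (hξ : Tendsto ξ l (𝓝 x)) :
    Tendsto (fun j => gradient (galerkin e v (n j)) (ξ j)) l (𝓝 (gradient v x)) := by
  simp only [gradient_galerkin e hv]
  exact tendsto_proj e hn (((continuous_gradient hv).tendsto x).comp (tendsto_proj e hn hξ))

theorem tendsto_hess_galerkin (hv : ContDiff ℝ 2 v) (hn : Tendsto n l atTop)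
    (hξ : Tendsto ξ l (𝓝 x)) (h : H) :
    Tendsto (fun j => hess (galerkin e v (n j)) (ξ j) h) l (𝓝 (hess v x h)) := by
  simp only [hess_galerkin_apply e hv]
  have h1 : Tendsto (fun j => hess v (proj e (n j) (ξ j))) l (𝓝 (hess v x)) :=
    ((continuous_hess hv).tendsto x).comp (tendsto_proj e hn hξ)
  exact tendsto_proj e hn (tendsto_clm_apply h1 (tendsto_proj e hn tendsto_const_nhds))

theorem eventually_norm_hess_galerkin_le (hv : ContDiff ℝ 2 v) (hn : Tendsto n l atTop)
    (hξ : Tendsto ξ l (𝓝 x)) :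
    ∀ᶠ j in l, ‖hess (galerkin e v (n j)) (ξ j)‖ ≤ ‖hess v x‖ + 1 := by
  have h1 : Tendsto (fun j => ‖hess v (proj e (n j) (ξ j))‖) l (𝓝 ‖hess v x‖) :=
    (((continuous_hess hv).tendsto x).comp (tendsto_proj e hn hξ)).norm
  filter_upwards [h1.eventually_le_const (lt_add_one _)] with j hj
  exact (norm_hess_galerkin_le e hv _ _).trans hj

variable {g : ∀ j, EuclideanSpace ℝ (Fin (n j)) → ℝ}

theorem tendsto_comp_coord (hv : ContDiff ℝ 2 v) (hn : Tendsto n l atTop)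
    (hξ : Tendsto ξ l (𝓝 x))
    (hΔ : Tendsto (fun j => galerkinError L e v (n j) (g j) (ξ j)) l (𝓝 0)) :
    Tendsto (fun j => g j (coord e (n j) (ξ j))) l (𝓝 (v x)) := by
  have h1 : Tendsto (fun j => galerkin e v (n j) (ξ j) - g j (coord e (n j) (ξ j))) l (𝓝 0) :=
    squeeze_zero_norm (fun j => abs_galerkin_sub_le _) hΔ
  simpa using (tendsto_galerkin (e := e) hv hn hξ).sub h1

theorem tendsto_gradient_comp_coord (hv : ContDiff ℝ 2 v) (hg : ∀ j, ContDiff ℝ 2 (g j))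
    (hn : Tendsto n l atTop) (hξ : Tendsto ξ l (𝓝 x))
    (hΔ : Tendsto (fun j => galerkinError L e v (n j) (g j) (ξ j)) l (𝓝 0)) :
    Tendsto (fun j => gradient (fun z => g j (coord e (n j) z)) (ξ j)) l (𝓝 (gradient v x)) := by
  have h1 : Tendsto (fun j => gradient (galerkin e v (n j)) (ξ j)
      - gradient (fun z => g j (coord e (n j) z)) (ξ j)) l (𝓝 0) :=
    squeeze_zero_norm (fun j => norm_gradient_galerkin_sub_le hv (hg j) _) hΔ
  simpa using (tendsto_gradient_galerkin (e := e) hv hn hξ).sub h1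

/-- The network Hessian is close to the Galerkin Hessian in operator norm, and the latter converges
strongly. -/
theorem tendsto_hess_comp_coord (hv : ContDiff ℝ 2 v) (hg : ∀ j, ContDiff ℝ 2 (g j))
    (hn : Tendsto n l atTop) (hξ : Tendsto ξ l (𝓝 x))
    (hΔ : Tendsto (fun j => galerkinError L e v (n j) (g j) (ξ j)) l (𝓝 0)) (h : H) :
    Tendsto (fun j => hess (fun z => g j (coord e (n j) z)) (ξ j) h) l (𝓝 (hess v x h)) := by
  have h1 : Tendsto (fun j => hess (galerkin e v (n j)) (ξ j)
      - hess (fun z => g j (coord e (n j) z)) (ξ j)) l (𝓝 0) :=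
    squeeze_zero_norm (fun j => norm_hess_galerkin_sub_le hv (hg j) _) hΔ
  have h2 := (tendsto_hess_galerkin (e := e) hv hn hξ h).sub
    (tendsto_clm_apply h1 (tendsto_const_nhds (x := h)))
  simpa using h2

theorem eventually_norm_hess_comp_coord_le (hv : ContDiff ℝ 2 v) (hg : ∀ j, ContDiff ℝ 2 (g j))
    (hn : Tendsto n l atTop) (hξ : Tendsto ξ l (𝓝 x))
    (hΔ : Tendsto (fun j => galerkinError L e v (n j) (g j) (ξ j)) l (𝓝 0)) :
    ∀ᶠ j in l, ‖hess (fun z => g j (coord e (n j) z)) (ξ j)‖ ≤ ‖hess v x‖ + 2 := by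
  filter_upwards [eventually_norm_hess_galerkin_le (e := e) hv hn hξ,
    hΔ.eventually_le_const one_pos] with j h1 h2
  have h3 := norm_hess_galerkin_sub_le (L := L) (e := e) hv (hg j) (ξ j)
  have h4 := norm_le_norm_add_norm_sub' (hess (fun z => g j (coord e (n j) z)) (ξ j))
    (hess (galerkin e v (n j)) (ξ j))
  rw [norm_sub_rev] at h4
  linarith

end Limits

end Galerkin

/-! ### Convergence of Hamiltonians and feedbacks. -/

section Control

variable {H Ξ Ut : Type*}
  [NormedAddCommGroup H] [InnerProductSpace ℝ H] [CompleteSpace H]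
  [NormedAddCommGroup Ξ] [InnerProductSpace ℝ Ξ] [CompleteSpace Ξ]
  {U : Set Ut} {c : Coefficients H Ξ U} {e : HilbertBasis ℕ ℝ H}
  {Ψ : H → H → (H →L[ℝ] H) → U} {L : H →ₗ.[ℝ] H} {v : H → ℝ}
  {J : Type*} {l : Filter J} {n : J → ℕ} {ξ : J → H} {x : H}
  {g : ∀ j, EuclideanSpace ℝ (Fin (n j)) → ℝ}

/-- Subtracting the equation for `v` leaves only differences, each of which is small. -/
theorem residual_comp_coord_eq {γ : ℝ}
    (hv : IsClassicalSolution L (hamiltonian c e γ) v) (he : ∀ i, e i ∈ L.domain) {d : ℕ}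
    {g : EuclideanSpace ℝ (Fin d) → ℝ} (hg : ContDiff ℝ 2 g) (x : H) :
    residual L (hamiltonian c e γ) (fun x => g (coord e d x)) x =
      (hamiltonian c e γ x (g (coord e d x)) (gradient (fun x => g (coord e d x)) x)
        (hess (fun x => g (coord e d x)) x)
        - hamiltonian c e γ x (v x) (gradient v x) (hess v x))
      - ⟪opApply L (gradient v x - gradient (fun x => g (coord e d x)) x), x⟫ := by
  have h1 := hv.equation x
  rw [opApply_sub (hv.mem_domain x) (gradient_comp_coord_mem_domain he hg x), inner_sub_left]
  simp only [residual] at h1 ⊢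
  linarith

variable [NormedAddCommGroup Ut]

theorem continuous_hamiltonian_comp (hc : c.Regular) (hU : IsCompact U)
    (hΨ : ∀ (x p : H) (Z : H →L[ℝ] H), IsSelfAdjoint Z → argminFcv c e x p Z = {Ψ x p Z})
    (γ : ℝ) (hv : ContDiff ℝ 2 v) :
    Continuous fun x => hamiltonian c e γ x (v x) (gradient v x) (hess v x) :=
  continuous_iff_continuousAt.2 fun x =>
    tendsto_hamiltonian hc hU hΨ γ tendsto_id (hv.continuous.tendsto x)
      ((continuous_gradient hv).tendsto x)
      (fun _ => tendsto_clm_apply ((continuous_hess hv).tendsto x) tendsto_const_nhds)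
      (((continuous_hess hv).tendsto x).norm.eventually_le_const (lt_add_one _))
      (fun j => isSelfAdjoint_hess hv j) (isSelfAdjoint_hess hv x)

theorem continuous_feedback (hc : c.Regular) (hU : IsCompact U)
    (hΨ : ∀ (x p : H) (Z : H →L[ℝ] H), IsSelfAdjoint Z → argminFcv c e x p Z = {Ψ x p Z})
    (hv : ContDiff ℝ 2 v) : Continuous (feedback Ψ v) :=
  continuous_subtype_val.comp <| continuous_iff_continuousAt.2 fun x =>
    tendsto_argmin hc hU hΨ tendsto_id ((continuous_gradient hv).tendsto x)
      (fun _ => tendsto_clm_apply ((continuous_hess hv).tendsto x) tendsto_const_nhds)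
      (((continuous_hess hv).tendsto x).norm.eventually_le_const (lt_add_one _))
      (fun j => isSelfAdjoint_hess hv j) (isSelfAdjoint_hess hv x)

/-- Both Hamiltonians tend to the same value at `x`, the second by continuity along `v`. -/
theorem tendsto_hamiltonian_sub (hc : c.Regular) (hU : IsCompact U)
    (hΨ : ∀ (x p : H) (Z : H →L[ℝ] H), IsSelfAdjoint Z → argminFcv c e x p Z = {Ψ x p Z})
    (γ : ℝ) (hv : ContDiff ℝ 2 v) (hg : ∀ j, ContDiff ℝ 2 (g j))
    (hn : Tendsto n l atTop) (hξ : Tendsto ξ l (𝓝 x))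
    (hΔ : Tendsto (fun j => galerkinError L e v (n j) (g j) (ξ j)) l (𝓝 0)) :
    Tendsto (fun j => hamiltonian c e γ (ξ j) (g j (coord e (n j) (ξ j)))
        (gradient (fun z => g j (coord e (n j) z)) (ξ j))
        (hess (fun z => g j (coord e (n j) z)) (ξ j))
      - hamiltonian c e γ (ξ j) (v (ξ j)) (gradient v (ξ j)) (hess v (ξ j))) l (𝓝 0) := by
  have h1 := tendsto_hamiltonian hc hU hΨ γ hξ (tendsto_comp_coord hv hn hξ hΔ)
    (tendsto_gradient_comp_coord hv hg hn hξ hΔ) (tendsto_hess_comp_coord hv hg hn hξ hΔ)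
    (eventually_norm_hess_comp_coord_le hv hg hn hξ hΔ)
    (fun j => isSelfAdjoint_hess (contDiff_comp_coord e (n j) (hg j)) (ξ j))
    (isSelfAdjoint_hess hv x)
  have h2 := ((continuous_hamiltonian_comp hc hU hΨ γ hv).tendsto x).comp hξ
  simpa using h1.sub h2

theorem tendsto_feedback_sub (hc : c.Regular) (hU : IsCompact U)
    (hΨ : ∀ (x p : H) (Z : H →L[ℝ] H), IsSelfAdjoint Z → argminFcv c e x p Z = {Ψ x p Z})
    (hv : ContDiff ℝ 2 v) (hg : ∀ j, ContDiff ℝ 2 (g j))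
    (hn : Tendsto n l atTop) (hξ : Tendsto ξ l (𝓝 x))
    (hΔ : Tendsto (fun j => galerkinError L e v (n j) (g j) (ξ j)) l (𝓝 0)) :
    Tendsto (fun j => feedback Ψ v (ξ j) - feedback Ψ (fun z => g j (coord e (n j) z)) (ξ j))
      l (𝓝 0) := by
  have h1 := tendsto_argmin hc hU hΨ hξ
    (tendsto_gradient_comp_coord hv hg hn hξ hΔ) (tendsto_hess_comp_coord hv hg hn hξ hΔ)
    (eventually_norm_hess_comp_coord_le hv hg hn hξ hΔ)
    (fun j => isSelfAdjoint_hess (contDiff_comp_coord e (n j) (hg j)) (ξ j))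
    (isSelfAdjoint_hess hv x)
  have h2 := ((continuous_feedback hc hU hΨ hv).tendsto x).comp hξ
  have h3 := h2.sub ((continuous_subtype_val.tendsto _).comp h1)
  rw [feedback, sub_self] at h3
  exact h3

end Control

/-! ### From joint convergence to uniform convergence on compacts. -/

section Compact

theorem tendsto_of_tendstoUniformlyOn_zero {X : Type*} [TopologicalSpace X] {K : Set X}
    {F : ℕ → X → ℝ} (hF : TendstoUniformlyOn F 0 atTop K) (x : X) :
    Tendsto (fun q : ℕ × X => F q.1 q.2) (atTop ×ˢ 𝓝[K] x) (𝓝 0) := by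
  refine Metric.tendsto_nhds.2 fun ε hε => ?_
  have h1 := Metric.tendstoUniformlyOn_iff.1 hF ε hε
  filter_upwards [h1.prod_mk (eventually_mem_nhdsWithin (a := x) (s := K))] with q hq
  rw [dist_comm]
  exact hq.1 q.2 hq.2

/-- Joint convergence at `x` gives a neighbourhood on which the bound holds for all large `m`;
finitely many such neighbourhoods cover `K`. -/
theorem eventually_forall_norm_lt_of_isCompact {X G : Type*} [TopologicalSpace X]
    [SeminormedAddCommGroup G] {K : Set X} (hK : IsCompact K) {F : ℕ → X → G}
    (hF : ∀ x ∈ K, Tendsto (fun q : ℕ × X => F q.1 q.2) (atTop ×ˢ 𝓝[K] x) (𝓝 0))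
    {ε : ℝ} (hε : 0 < ε) : ∀ᶠ m in atTop, ∀ x ∈ K, ‖F m x‖ < ε := by
  refine hK.induction_on (p := fun s => ∀ᶠ m in atTop, ∀ x ∈ s, ‖F m x‖ < ε) (by simp)
    (fun s t hst ht => ht.mono fun m hm x hx => hm x (hst hx))
    (fun s t hs ht => ?_) fun x hx => ?_
  · filter_upwards [hs, ht] with m h1 h2 x hx
    exact hx.elim (h1 x) (h2 x)
  · have h1 : ∀ᶠ q in atTop ×ˢ 𝓝[K] x, ‖F q.1 q.2‖ < ε := by
      simpa using (hF x hx).norm.eventually_lt_const (by simpa using hε)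
    obtain ⟨pa, ha, pb, hb, hab⟩ := eventually_prod_iff.1 h1
    exact ⟨{y | pb y}, hb, ha.mono fun m hm y hy => hab hm hy⟩

end Compact

/-! ### Part (i): approximation on compact sets. -/

section UniformApproximation

variable {H Ξ Ut : Type*}
  [NormedAddCommGroup H] [InnerProductSpace ℝ H] [CompleteSpace H]
  [NormedAddCommGroup Ξ] [InnerProductSpace ℝ Ξ] [CompleteSpace Ξ]
  {e : HilbertBasis ℕ ℝ H} {L : H →ₗ.[ℝ] H} {v : H → ℝ}
  {Θ : ℕ → Type*} {f : ∀ d, Θ d → EuclideanSpace ℝ (Fin d) → ℝ}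

theorem exists_galerkinError_lt (huniv : UniversalOnCompacts f) (hv : ContDiff ℝ 2 v) {d : ℕ}
    (hd : 1 ≤ d) {K : Set H} (hK : IsCompact K) {δ : ℝ} (hδ : 0 < δ) :
    ∃ θ : Θ d, ∀ x ∈ K, galerkinError L e v d (f d θ) x < δ := by
  have h0 : 0 < 1 + galerkinBound L e d := by linarith [galerkinBound_nonneg L e d]
  -- The dimension is already fixed, so the tolerance may be divided by the weight `1 +
  -- galerkinBound L e d`.
  obtain ⟨θ, hθ⟩ := huniv d hd _ (contDiff_comp_embed e hv d) (coord e d '' K)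
    (hK.image (continuous_coord e d)) (δ / (1 + galerkinBound L e d)) (div_pos hδ h0)
  refine ⟨θ, fun x hx => ?_⟩
  obtain ⟨h1, h2, h3⟩ := hθ _ (Set.mem_image_of_mem _ hx)
  rw [galerkinError, mul_comm, ← lt_div_iff₀ h0]
  exact max_lt h1 (max_lt h2 h3)

variable {U : Set Ut} {c : Coefficients H Ξ U} {Ψ : H → H → (H →L[ℝ] H) → U} {γ : ℝ}

theorem exists_approximation_on_compacts [NormedAddCommGroup Ut] (hc : c.Regular)
    (hU : IsCompact U)
    (hΨ : ∀ (x p : H) (Z : H →L[ℝ] H), IsSelfAdjoint Z → argminFcv c e x p Z = {Ψ x p Z})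
    (he : ∀ i, e i ∈ L.domain) (hv : IsClassicalSolution L (hamiltonian c e γ) v)
    (hf : ∀ d θ, ContDiff ℝ 2 (f d θ)) (huniv : UniversalOnCompacts f)
    {K K' : Set H} (hK : IsCompact K) (hK' : IsCompact K')
    (hcons : TendstoUniformlyOn (consistencyError L e v) 0 atTop K) {ε : ℝ} (hε : 0 < ε) :
    ∃ d : ℕ, 1 ≤ d ∧ ∃ θ : Θ d,
      (∀ x, gradient (hgno e f d θ) x ∈ L.domain) ∧
      (∀ x ∈ K, |v x - hgno e f d θ x| < ε) ∧
      (∀ x ∈ K, ‖gradient v x - gradient (hgno e f d θ) x‖ < ε) ∧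
      (∀ x ∈ K, ∀ h ∈ K', ‖(hess v x - hess (hgno e f d θ) x) h‖ < ε) ∧
      (∀ x ∈ K, |⟪opApply L (gradient v x - gradient (hgno e f d θ) x), x⟫| < ε) ∧
      (∀ x ∈ K, |residual L (hamiltonian c e γ) (hgno e f d θ) x| < ε) ∧
      (∀ x ∈ K, ‖feedback Ψ v x - feedback Ψ (hgno e f d θ) x‖ < ε) := by
  have hv2 := hv.contDiff
  -- Dimension `m + 1`, because universality is available for `d ≥ 1` only, with tolerance `1 / (m +
  -- 1)`.
  choose θ hθ using fun m : ℕ => exists_galerkinError_lt (L := L) (e := e) huniv hv2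
    (Nat.le_add_left 1 m) hK (Nat.one_div_pos_of_nat (α := ℝ) (n := m))
  have hΔ : ∀ {J : Type _} {l : Filter J} {m : J → ℕ} {ξ : J → H}, Tendsto m l atTop →
      (∀ᶠ j in l, ξ j ∈ K) → Tendsto (fun j => galerkinError L e v (m j + 1)
        (f (m j + 1) (θ (m j))) (ξ j)) l (𝓝 0) := by
    intro J l m ξ hm hξ
    exact squeeze_zero' (Eventually.of_forall fun j => galerkinError_nonneg _)
      (hξ.mono fun j hj => (hθ (m j) (ξ j) hj).le)
      (tendsto_one_div_add_atTop_nhds_zero_nat.comp hm)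
  have hg : ∀ m, ContDiff ℝ 2 (f (m + 1) (θ m)) := fun m => hf _ _
  have hn : ∀ x, Tendsto (fun q : ℕ × H => q.1 + 1) (atTop ×ˢ 𝓝[K] x) atTop := fun x =>
    (tendsto_add_atTop_nat 1).comp tendsto_fst
  have hξ : ∀ x, Tendsto (fun q : ℕ × H => q.2) (atTop ×ˢ 𝓝[K] x) (𝓝 x) := fun x =>
    tendsto_snd.mono_right nhdsWithin_le_nhds
  have hmem : ∀ x, ∀ᶠ q : ℕ × H in atTop ×ˢ 𝓝[K] x, q.2 ∈ K := fun x =>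
    tendsto_snd.eventually eventually_mem_nhdsWithin
  have hΔK : ∀ x, Tendsto (fun q : ℕ × H => galerkinError L e v (q.1 + 1)
      (f (q.1 + 1) (θ q.1)) q.2) (atTop ×ˢ 𝓝[K] x) (𝓝 0) := fun x => hΔ tendsto_fst (hmem x)
  have hinner : ∀ x, Tendsto (fun q : ℕ × H => ⟪opApply L (gradient v q.2
      - gradient (hgno e f (q.1 + 1) (θ q.1)) q.2), q.2⟫) (atTop ×ˢ 𝓝[K] x) (𝓝 0) := by
    intro x
    have h1 : Tendsto (fun q : ℕ × H => consistencyError L e v (q.1 + 1) q.2)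
        (atTop ×ˢ 𝓝[K] x) (𝓝 0) :=
      (tendsto_of_tendstoUniformlyOn_zero hcons x).comp ((hn x).prodMk tendsto_snd)
    have h2 := h1.abs.add ((hΔK x).mul (hξ x).norm)
    rw [abs_zero, zero_mul, add_zero] at h2
    exact squeeze_zero_norm (fun q => abs_inner_opApply_gradient_sub_le hv2 (hg q.1) he
      (hv.mem_domain q.2)) h2
  have hham := fun x => tendsto_hamiltonian_sub hc hU hΨ γ hv2 (fun q : ℕ × H => hg q.1) (hn x)
    (hξ x) (hΔK x)
  have e1 := eventually_forall_norm_lt_of_isCompact hK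
    (F := fun m x => v x - hgno e f (m + 1) (θ m) x) (fun x _ => by
      have h1 := ((hv2.continuous.tendsto x).comp (hξ x)).sub
        (tendsto_comp_coord hv2 (hn x) (hξ x) (hΔK x))
      rw [sub_self] at h1
      exact h1) hε
  have e2 := eventually_forall_norm_lt_of_isCompact hK
    (F := fun m x => gradient v x - gradient (hgno e f (m + 1) (θ m)) x) (fun x _ => by
      have h1 := (((continuous_gradient hv2).tendsto x).comp (hξ x)).sub
        (tendsto_gradient_comp_coord hv2 (fun q : ℕ × H => hg q.1) (hn x) (hξ x) (hΔK x))
      rw [sub_self] at h1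
      exact h1) hε
  -- Working on the compact product `K ×ˢ K'` makes strong convergence with a local norm bound
  -- sufficient.
  have e3 := eventually_forall_norm_lt_of_isCompact (hK.prod hK')
    (F := fun m z => (hess v z.1 - hess (hgno e f (m + 1) (θ m)) z.1) z.2) (fun z _ => by
      have k1 : Tendsto (fun q : ℕ × (H × H) => q.1 + 1) (atTop ×ˢ 𝓝[K ×ˢ K'] z) atTop :=
        (tendsto_add_atTop_nat 1).comp tendsto_fst
      have k2 : Tendsto (fun q : ℕ × (H × H) => q.2) (atTop ×ˢ 𝓝[K ×ˢ K'] z) (𝓝 z) :=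
        tendsto_snd.mono_right nhdsWithin_le_nhds
      have k3 : Tendsto (fun q : ℕ × (H × H) => q.2.1) (atTop ×ˢ 𝓝[K ×ˢ K'] z) (𝓝 z.1) :=
        (continuous_fst.tendsto z).comp k2
      have k4 : Tendsto (fun q : ℕ × (H × H) => q.2.2) (atTop ×ˢ 𝓝[K ×ˢ K'] z) (𝓝 z.2) :=
        (continuous_snd.tendsto z).comp k2
      have k5 : ∀ᶠ q : ℕ × (H × H) in atTop ×ˢ 𝓝[K ×ˢ K'] z, q.2.1 ∈ K :=
        (tendsto_snd.eventually eventually_mem_nhdsWithin).mono fun q hq => hq.1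
      have k6 := hΔ tendsto_fst k5
      have k7 := tendsto_apply_of_strong
        (tendsto_hess_comp_coord hv2 (fun q : ℕ × (H × H) => hg q.1) k1 k3 k6)
        (eventually_norm_hess_comp_coord_le hv2 (fun q : ℕ × (H × H) => hg q.1) k1 k3 k6) k4
      have k8 := (tendsto_clm_apply (((continuous_hess hv2).tendsto z.1).comp k3) k4).sub k7
      rw [sub_self] at k8
      exact k8) hε
  have e4 := eventually_forall_norm_lt_of_isCompact hK
    (F := fun m x => ⟪opApply L (gradient v x - gradient (hgno e f (m + 1) (θ m)) x), x⟫)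
    (fun x _ => hinner x) hε
  have e5 := eventually_forall_norm_lt_of_isCompact hK
    (F := fun m x => residual L (hamiltonian c e γ) (hgno e f (m + 1) (θ m)) x) (fun x _ => by
      have h1 := (hham x).sub (hinner x)
      rw [sub_zero] at h1
      exact h1.congr fun q => (residual_comp_coord_eq hv he (hg q.1) q.2).symm) hε
  have e6 := eventually_forall_norm_lt_of_isCompact hK
    (F := fun m x => feedback Ψ v x - feedback Ψ (hgno e f (m + 1) (θ m)) x) (fun x _ =>
      tendsto_feedback_sub hc hU hΨ hv2 (fun q : ℕ × H => hg q.1) (hn x) (hξ x) (hΔK x)) hε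
  obtain ⟨m, h1, h2, h3, h4, h5, h6⟩ :=
    (e1.and (e2.and (e3.and (e4.and (e5.and e6))))).exists
  exact ⟨m + 1, Nat.le_add_left 1 m, θ m, gradient_comp_coord_mem_domain he (hg m), h1, h2,
    fun x hx h hh => h3 (x, h) ⟨hx, hh⟩, h4, h5, h6⟩

end UniformApproximation

/-! ### Dominated convergence and elementary integral inequalities. -/

section Integrals

theorem ennreal_add_pow_le (a b : ℝ≥0∞) (n : ℕ) : (a + b) ^ n ≤ 2 ^ n * (a ^ n + b ^ n) := by
  have := ENNReal.add_rpow_le_two_rpow_mul_rpow_add_rpow (p := n) a b (Nat.cast_nonneg n)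
  simpa only [ENNReal.rpow_natCast] using this

theorem tendsto_lintegral_enorm_pow_zero {X G : Type*} [MeasurableSpace X] {μ : Measure X}
    [SeminormedAddCommGroup G] {F : ℕ → X → G} {p : ℕ} (hp : p ≠ 0)
    (hF : ∀ n, AEMeasurable (fun x => ‖F n x‖ₑ ^ p) μ) {bound : X → ℝ≥0∞}
    (hbound : ∀ n, ∀ᵐ x ∂μ, ‖F n x‖ₑ ^ p ≤ bound x) (hfin : ∫⁻ x, bound x ∂μ ≠ ∞)
    (hlim : ∀ᵐ x ∂μ, Tendsto (fun n => F n x) atTop (𝓝 0)) :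
    Tendsto (fun n => ∫⁻ x, ‖F n x‖ₑ ^ p ∂μ) atTop (𝓝 0) := by
  have h := tendsto_lintegral_of_dominated_convergence' (f := fun _ => 0) bound hF hbound hfin
    (hlim.mono fun x hx => by
      have h := ((ENNReal.continuous_pow p).tendsto _).comp
        (tendsto_zero_iff_enorm_tendsto_zero.1 hx)
      rwa [zero_pow hp] at h)
  simpa using h

theorem enorm_pow_le_of_norm_le {G : Type*} [SeminormedAddCommGroup G] {y : G} {a b : ℝ}
    (ha : 0 ≤ a) (hb : 0 ≤ b) (h : ‖y‖ ≤ a + b) (n : ℕ) :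
    ‖y‖ₑ ^ n ≤ 2 ^ n * (‖a‖ₑ ^ n + ‖b‖ₑ ^ n) := by
  refine le_trans ?_ (ennreal_add_pow_le _ _ n)
  gcongr
  rw [← ofReal_norm, Real.enorm_of_nonneg ha, Real.enorm_of_nonneg hb, ← ENNReal.ofReal_add ha hb]
  exact ENNReal.ofReal_le_ofReal h

/-- If `∑ₙ ∫ ‖F n‖^p < ∞` then `F n → 0` almost everywhere, and the `‖F n‖^p` have a common
integrable bound. -/
theorem ae_tendsto_zero_of_tsum_lintegral_ne_top {X G : Type*} [MeasurableSpace X]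
    {μ : Measure X} [SeminormedAddCommGroup G] {F : ℕ → X → G} {p : ℕ} (hp : p ≠ 0)
    (hF : ∀ n, AEMeasurable (fun x => ‖F n x‖ₑ ^ p) μ)
    (hsum : ∑' n, ∫⁻ x, ‖F n x‖ₑ ^ p ∂μ ≠ ∞) :
    ∫⁻ x, ∑' n, ‖F n x‖ₑ ^ p ∂μ ≠ ∞ ∧ ∀ᵐ x ∂μ, Tendsto (fun n => F n x) atTop (𝓝 0) := by
  rw [← lintegral_tsum hF] at hsum
  refine ⟨hsum, ?_⟩
  filter_upwards [ae_lt_top' (AEMeasurable.tsum hF) hsum] with x hx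
  have h1 := ENNReal.tendsto_atTop_zero_of_tsum_ne_top hx.ne
  rw [tendsto_zero_iff_enorm_tendsto_zero, ENNReal.tendsto_nhds_zero]
  intro ε hε
  filter_upwards [ENNReal.tendsto_nhds_zero.1 h1 (ε ^ p) (ENNReal.pow_pos hε p)] with n hn
  exact (ENNReal.pow_le_pow_left_iff hp).1 hn

theorem norm_le_one_add_rpow {E : Type*} [NormedAddCommGroup E] {k : ℝ} (hk : 1 ≤ k) (x : E) :
    ‖x‖ ≤ 1 + ‖x‖ ^ k := by
  have h0 : 0 ≤ ‖x‖ ^ k := by positivity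
  rcases le_total ‖x‖ 1 with h | h
  · linarith
  · linarith [Real.self_le_rpow_of_one_le h hk]

theorem lintegral_one_add_rpow_pow_four_lt_top {E : Type*} [NormedAddCommGroup E]
    [MeasurableSpace E] {μ : Measure E} [IsFiniteMeasure μ] {k : ℝ} (hk : 0 ≤ k)
    (hμ : ∫⁻ x : E, ‖x‖ₑ ^ (4 * k) ∂μ < ∞) : ∫⁻ x : E, ‖(1 + ‖x‖ ^ k : ℝ)‖ₑ ^ 4 ∂μ < ∞ := by
  have h1 : ∀ x : E, ‖(1 + ‖x‖ ^ k : ℝ)‖ₑ ^ 4 ≤ 2 ^ 4 * (1 + ‖x‖ₑ ^ (4 * k)) := by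
    intro x
    refine (enorm_pow_le_of_norm_le zero_le_one (by positivity : 0 ≤ ‖x‖ ^ k) ?_ 4).trans ?_
    · rw [Real.norm_of_nonneg (by positivity)]
    · rw [Real.enorm_rpow_of_nonneg (norm_nonneg x) hk, enorm_norm, mul_comm 4 k,
        ENNReal.rpow_mul]
      norm_num
  refine (lintegral_mono h1).trans_lt ?_
  rw [lintegral_const_mul' _ _ (by norm_num), lintegral_add_left measurable_const]
  refine ENNReal.mul_lt_top (by norm_num) (ENNReal.add_lt_top.2 ⟨?_, hμ⟩)
  simp

theorem enorm_pow_le_of_norm_le_of_enorm_pow_le {G : Type*} [SeminormedAddCommGroup G] {y : G}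
    {a b : ℝ} (ha : 0 ≤ a) (hb : 0 ≤ b) (h : ‖y‖ ≤ a + b) {n : ℕ} {s : ℝ≥0∞}
    (hs : ‖b‖ₑ ^ n ≤ s) : ‖y‖ₑ ^ n ≤ 2 ^ n * (‖a‖ₑ ^ n + s) :=
  (enorm_pow_le_of_norm_le ha hb h n).trans (by gcongr)

/-- A product of two functions in `L⁴` is in `L²`: hence fourth powers for the derivatives and
squares for the `L` term and the residual. -/
theorem mul_pow_two_le_pow_four_add (a b : ℝ≥0∞) : (a * b) ^ 2 ≤ a ^ 4 + b ^ 4 := by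
  rcases le_total a b with h | h
  · calc (a * b) ^ 2 ≤ (b * b) ^ 2 := by gcongr
      _ = b ^ 4 := by ring
      _ ≤ _ := le_add_self
  · calc (a * b) ^ 2 ≤ (a * a) ^ 2 := by gcongr
      _ = a ^ 4 := by ring
      _ ≤ _ := le_self_add

/-- Measurability of one of the two majorants is enough to split the integral, so nothing has to be
checked for the terms containing the consistency error. -/
theorem tendsto_lintegral_enorm_pow_zero_of_le {X G G₁ G₂ : Type*} [MeasurableSpace X]
    {μ : Measure X} [SeminormedAddCommGroup G] [SeminormedAddCommGroup G₁]
    [SeminormedAddCommGroup G₂] {F : ℕ → X → G} {a : ℕ → X → G₁} {b : ℕ → X → G₂} (p : ℕ)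
    (hF : ∀ n x, ‖F n x‖ ≤ ‖a n x‖ + ‖b n x‖) (hb : ∀ n, AEMeasurable (fun x => ‖b n x‖ₑ ^ p) μ)
    (ha0 : Tendsto (fun n => ∫⁻ x, ‖a n x‖ₑ ^ p ∂μ) atTop (𝓝 0))
    (hb0 : Tendsto (fun n => ∫⁻ x, ‖b n x‖ₑ ^ p ∂μ) atTop (𝓝 0)) :
    Tendsto (fun n => ∫⁻ x, ‖F n x‖ₑ ^ p ∂μ) atTop (𝓝 0) := by
  have h1 := ENNReal.Tendsto.const_mul (a := 2 ^ p) (ha0.add hb0) (Or.inr (by simp))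
  rw [add_zero, mul_zero] at h1
  refine tendsto_of_tendsto_of_tendsto_of_le_of_le tendsto_const_nhds h1 (fun _ => zero_le)
    fun n => ?_
  change ∫⁻ x, ‖F n x‖ₑ ^ p ∂μ ≤ 2 ^ p * (∫⁻ x, ‖a n x‖ₑ ^ p ∂μ + ∫⁻ x, ‖b n x‖ₑ ^ p ∂μ)
  rw [← lintegral_add_right' _ (hb n), ← lintegral_const_mul' _ _ (by simp)]
  refine lintegral_mono fun x => ?_
  simpa only [enorm_norm] using
    enorm_pow_le_of_norm_le (norm_nonneg (a n x)) (norm_nonneg (b n x)) (hF n x) p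

end Integrals

/-! ### Growth bounds and Sobolev approximation under the pushforward measure. -/

section MeanApproximation

variable {H Ξ Ut : Type*}
  [NormedAddCommGroup H] [InnerProductSpace ℝ H] [CompleteSpace H]
  [NormedAddCommGroup Ξ] [InnerProductSpace ℝ Ξ] [CompleteSpace Ξ]
  {e : HilbertBasis ℕ ℝ H} {L : H →ₗ.[ℝ] H} {v : H → ℝ} {d : ℕ}
  {g : EuclideanSpace ℝ (Fin d) → ℝ} {k C : ℝ}

/-- Triangle inequality through `v ∘ P_d`. The growth bound is used at `x` and at `P_d x`, whence
the factor two, and `‖P_d x‖ ≤ ‖x‖` keeps it uniform in `d`. -/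
theorem abs_sub_comp_coord_le (hk : 0 ≤ k) (hC : ∀ x, |v x| ≤ C * (1 + ‖x‖ ^ k)) (x : H) :
    |v x - g (coord e d x)| ≤ 2 * |C| * (1 + ‖x‖ ^ k) + galerkinError L e v d g x := by
  have h1 := abs_galerkin_sub_le (L := L) (e := e) (v := v) (g := g) x
  have h2 : |galerkin e v d x| ≤ |C| * (1 + ‖x‖ ^ k) :=
    (hC _).trans (mul_le_mul (le_abs_self C)
      (by gcongr; exact norm_proj_le e d x) (by positivity) (abs_nonneg C))
  have h3 : |v x| ≤ |C| * (1 + ‖x‖ ^ k) := (hC x).trans (by gcongr; exact le_abs_self C)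
  have h4 := abs_sub_le (v x) (galerkin e v d x) (g (coord e d x))
  have h5 := abs_sub (v x) (galerkin e v d x)
  linarith

theorem norm_gradient_sub_comp_coord_le (hv : ContDiff ℝ 2 v) (hg : ContDiff ℝ 2 g) (hk : 0 ≤ k)
    (hC : ∀ x, ‖gradient v x‖ ≤ C * (1 + ‖x‖ ^ k)) (x : H) :
    ‖gradient v x - gradient (fun x => g (coord e d x)) x‖
      ≤ 2 * |C| * (1 + ‖x‖ ^ k) + galerkinError L e v d g x := by
  have h1 := norm_gradient_galerkin_sub_le (L := L) (e := e) hv hg x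
  have h2 : ‖gradient (galerkin e v d) x‖ ≤ |C| * (1 + ‖x‖ ^ k) := by
    rw [gradient_galerkin e hv]
    exact (norm_proj_le e d _).trans ((hC _).trans (mul_le_mul (le_abs_self C)
      (by gcongr; exact norm_proj_le e d x) (by positivity) (abs_nonneg C)))
  have h3 : ‖gradient v x‖ ≤ |C| * (1 + ‖x‖ ^ k) := (hC x).trans (by gcongr; exact le_abs_self C)
  have h4 := norm_sub_le_norm_sub_add_norm_sub (gradient v x) (gradient (galerkin e v d) x)
    (gradient (fun x => g (coord e d x)) x)
  have h5 := norm_sub_le (gradient v x) (gradient (galerkin e v d) x)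
  linarith

theorem norm_hess_sub_comp_coord_le (hv : ContDiff ℝ 2 v) (hg : ContDiff ℝ 2 g) (hk : 0 ≤ k)
    (hC : ∀ x, ‖hess v x‖ ≤ C * (1 + ‖x‖ ^ k)) (x : H) :
    ‖hess v x - hess (fun x => g (coord e d x)) x‖
      ≤ 2 * |C| * (1 + ‖x‖ ^ k) + galerkinError L e v d g x := by
  have h1 := norm_hess_galerkin_sub_le (L := L) (e := e) hv hg x
  have h2 : ‖hess (galerkin e v d) x‖ ≤ |C| * (1 + ‖x‖ ^ k) :=
    (norm_hess_galerkin_le e hv d x).trans ((hC _).trans (mul_le_mul (le_abs_self C)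
      (by gcongr; exact norm_proj_le e d x) (by positivity) (abs_nonneg C)))
  have h3 : ‖hess v x‖ ≤ |C| * (1 + ‖x‖ ^ k) := (hC x).trans (by gcongr; exact le_abs_self C)
  have h4 := norm_sub_le_norm_sub_add_norm_sub (hess v x) (hess (galerkin e v d) x)
    (hess (fun x => g (coord e d x)) x)
  have h5 := norm_sub_le (hess v x) (hess (galerkin e v d) x)
  linarith

variable [MeasurableSpace H] [BorelSpace H] {μ : Measure H}

/-- Universality is applied on `ℝ^d` to the law of the coordinates under `μ`. Integrals against it
are integrals over `H` of functions of `P_d x`, for which the growth of `v` and the moment of `μ`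
suffice. -/
theorem sobolevEnergy_comp_embed_lt_top (hv : ContDiff ℝ 2 v) (hk : 0 ≤ k)
    (hC : ∀ x, |v x| + ‖gradient v x‖ + ‖hess v x‖ ≤ C * (1 + ‖x‖ ^ k))
    (hμ : ∫⁻ x : H, ‖(1 + ‖x‖ ^ k : ℝ)‖ₑ ^ 4 ∂μ < ∞) :
    sobolevEnergy 4 (μ.map (coord e d)) (fun y => v (embed e d y)) < ∞ := by
  have hvd := contDiff_comp_embed e hv d
  have hmeas : Measurable fun y : EuclideanSpace ℝ (Fin d) => ‖v (embed e d y)‖ₑ ^ 4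
      + ‖gradient (fun y => v (embed e d y)) y‖ₑ ^ 4
      + ‖hess (fun y => v (embed e d y)) y‖ₑ ^ 4 :=
    (((hvd.continuous.enorm.measurable).pow_const 4).add
      (((continuous_gradient hvd).enorm.measurable).pow_const 4)).add
      (((continuous_hess hvd).enorm.measurable).pow_const 4)
  rw [sobolevEnergy, lintegral_map hmeas (continuous_coord e d).measurable]
  have hb : ∀ x : H, ∀ a : ℝ, 0 ≤ a → a ≤ |v (proj e d x)| + ‖gradient v (proj e d x)‖
      + ‖hess v (proj e d x)‖ → ENNReal.ofReal a ^ 4 ≤ (‖C‖ₑ * ‖(1 + ‖x‖ ^ k : ℝ)‖ₑ) ^ 4 := by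
    intro x a ha hax
    gcongr
    rw [← enorm_mul, ← ofReal_norm, norm_mul, Real.norm_of_nonneg (by positivity : 0 ≤ 1 + ‖x‖ ^ k)]
    refine ENNReal.ofReal_le_ofReal (hax.trans ((hC _).trans ?_))
    exact mul_le_mul (le_abs_self C)
      (by gcongr; exact norm_proj_le e d x) (by positivity) (abs_nonneg C)
  have hle : ∀ x : H, ‖v (embed e d (coord e d x))‖ₑ ^ 4
      + ‖gradient (fun y => v (embed e d y)) (coord e d x)‖ₑ ^ 4
      + ‖hess (fun y => v (embed e d y)) (coord e d x)‖ₑ ^ 4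
      ≤ 3 * ‖C‖ₑ ^ 4 * ‖(1 + ‖x‖ ^ k : ℝ)‖ₑ ^ 4 := by
    intro x
    have n1 := abs_nonneg (v (proj e d x))
    have n2 := norm_nonneg (gradient v (proj e d x))
    have n3 := norm_nonneg (hess v (proj e d x))
    calc _ ≤ (‖C‖ₑ * ‖(1 + ‖x‖ ^ k : ℝ)‖ₑ) ^ 4 + (‖C‖ₑ * ‖(1 + ‖x‖ ^ k : ℝ)‖ₑ) ^ 4
          + (‖C‖ₑ * ‖(1 + ‖x‖ ^ k : ℝ)‖ₑ) ^ 4 := by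
          refine add_le_add (add_le_add ?_ ?_) ?_
          · rw [← ofReal_norm, embed_coord]
            exact hb x _ (norm_nonneg _) (by rw [Real.norm_eq_abs]; linarith)
          · rw [← ofReal_norm]
            refine hb x _ (norm_nonneg _) ?_
            rw [gradient_comp_embed e hv, embed_coord]
            linarith [norm_coord_le e d (gradient v (proj e d x))]
          · rw [← ofReal_norm]
            refine hb x _ (norm_nonneg _) ((norm_hess_comp_embed_le e hv d _).trans ?_)
            rw [embed_coord]
            linarith
      _ = _ := by ring
  refine (lintegral_mono hle).trans_lt ?_
  rw [lintegral_const_mul' _ _ (ENNReal.mul_ne_top (by norm_num) (by simp))]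
  exact ENNReal.mul_lt_top (ENNReal.mul_lt_top (by norm_num) (by simp)) hμ

theorem lintegral_galerkinError_pow_le (hv : ContDiff ℝ 2 v) (hg : ContDiff ℝ 2 g) :
    ∫⁻ x, ‖galerkinError L e v d g x‖ₑ ^ 4 ∂μ ≤ ‖1 + galerkinBound L e d‖ₑ ^ 4 *
      sobolevEnergy 4 (μ.map (coord e d)) (fun y => v (embed e d y) - g y) := by
  have hvd := (contDiff_comp_embed e hv d).sub hg
  have hmeas : Measurable fun y : EuclideanSpace ℝ (Fin d) => ‖v (embed e d y) - g y‖ₑ ^ 4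
      + ‖gradient (fun y => v (embed e d y) - g y) y‖ₑ ^ 4
      + ‖hess (fun y => v (embed e d y) - g y) y‖ₑ ^ 4 :=
    (((hvd.continuous.enorm.measurable).pow_const 4).add
      (((continuous_gradient hvd).enorm.measurable).pow_const 4)).add
      (((continuous_hess hvd).enorm.measurable).pow_const 4)
  rw [sobolevEnergy, lintegral_map hmeas (continuous_coord e d).measurable,
    ← lintegral_const_mul' _ _ (by simp)]
  refine lintegral_mono fun x => ?_
  rw [galerkinError, enorm_mul, mul_pow]
  gcongr
  have h3 : ∀ a b : ℝ, ‖max a b‖ₑ ^ 4 ≤ ‖a‖ₑ ^ 4 + ‖b‖ₑ ^ 4 := by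
    intro a b
    rcases max_cases a b with h | h
    · rw [h.1]; exact le_self_add
    · rw [h.1]; exact le_add_self
  refine (h3 _ _).trans ?_
  rw [add_assoc, Real.enorm_abs]
  gcongr
  refine (h3 _ _).trans ?_
  rw [enorm_norm, enorm_norm]

theorem exists_lintegral_galerkinError_lt {Θ : ℕ → Type*}
    {f : ∀ d, Θ d → EuclideanSpace ℝ (Fin d) → ℝ} [IsFiniteMeasure μ]
    (hf : ∀ d θ, ContDiff ℝ 2 (f d θ)) (huniv : UniversalInSobolev 4 f) (hd : 1 ≤ d)
    (hv : ContDiff ℝ 2 v) (hk : 0 ≤ k)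
    (hC : ∀ x, |v x| + ‖gradient v x‖ + ‖hess v x‖ ≤ C * (1 + ‖x‖ ^ k))
    (hμ : ∫⁻ x : H, ‖(1 + ‖x‖ ^ k : ℝ)‖ₑ ^ 4 ∂μ < ∞) {δ : ℝ} (hδ : 0 < δ) :
    ∃ θ : Θ d, ∫⁻ x, ‖galerkinError L e v d (f d θ) x‖ₑ ^ 4 ∂μ ≤ ENNReal.ofReal δ := by
  have h0 : 0 < 1 + galerkinBound L e d := by linarith [galerkinBound_nonneg L e d]
  -- The weight enters the fourth-power integral to the fourth power, so the tolerance is divided by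
  -- that.
  obtain ⟨θ, hθ⟩ := huniv d hd (μ.map (coord e d)) inferInstance _ (contDiff_comp_embed e hv d)
    (sobolevEnergy_comp_embed_lt_top hv hk hC hμ) (δ / (1 + galerkinBound L e d) ^ 4)
    (by positivity)
  refine ⟨θ, (lintegral_galerkinError_pow_le hv (hf d θ)).trans ?_⟩
  calc _ ≤ ‖1 + galerkinBound L e d‖ₑ ^ 4 * ENNReal.ofReal (δ / (1 + galerkinBound L e d) ^ 4) := by
        gcongr
    _ = ENNReal.ofReal δ := by
        rw [Real.enorm_of_nonneg h0.le, ← ENNReal.ofReal_pow h0.le,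
          ← ENNReal.ofReal_mul (by positivity), mul_div_cancel₀ _ (by positivity)]

end MeanApproximation

/-! ### Part (ii): dominated convergence of the errors. -/

section ErrorBound

/-- The common bound for the fourth powers of the approximation errors. -/
def errorBound {E : Type*} [NormedAddCommGroup E] (C k : ℝ) (S : E → ℝ≥0∞) (x : E) : ℝ≥0∞ :=
  2 ^ 4 * (‖2 * |C| * (1 + ‖x‖ ^ k)‖ₑ ^ 4 + S x)

theorem measurable_errorBound {E : Type*} [NormedAddCommGroup E] [MeasurableSpace E]
    [OpensMeasurableSpace E] {S : E → ℝ≥0∞} {C k : ℝ} (hS : Measurable S) :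
    Measurable (errorBound C k S) :=
  ((((measurable_norm.pow_const k).const_add 1).const_mul _).enorm.pow_const 4 |>.add
    hS).const_mul _

end ErrorBound

section MeanConvergence

variable {H : Type*}
  [NormedAddCommGroup H] [InnerProductSpace ℝ H] [CompleteSpace H] [MeasurableSpace H]

/-- The fourth powers of the Galerkin errors of the functions `g m` in `n m → ∞` coordinates have
the integrable bound `S`, and these errors tend to zero almost everywhere. -/
structure DominatedErrors (L : H →ₗ.[ℝ] H) (e : HilbertBasis ℕ ℝ H) (v : H → ℝ) (n : ℕ → ℕ)
    (g : ∀ m, EuclideanSpace ℝ (Fin (n m)) → ℝ) (S : H → ℝ≥0∞) (μ : Measure H) : Prop where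
  contDiff : ∀ m, ContDiff ℝ 2 (g m)
  tendsto_dim : Tendsto n atTop atTop
  measurable : Measurable S
  lintegral_ne_top : ∫⁻ x, S x ∂μ ≠ ∞
  le : ∀ m x, ‖galerkinError L e v (n m) (g m) x‖ₑ ^ 4 ≤ S x
  ae_tendsto : ∀ᵐ x ∂μ, Tendsto (fun m => galerkinError L e v (n m) (g m) x) atTop (𝓝 0)

variable {e : HilbertBasis ℕ ℝ H} {L : H →ₗ.[ℝ] H} {v : H → ℝ} {n : ℕ → ℕ}
  {g : ∀ m, EuclideanSpace ℝ (Fin (n m)) → ℝ} {S : H → ℝ≥0∞} {μ μ' : Measure H} {k C : ℝ}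

theorem lintegral_errorBound_ne_top (hD : DominatedErrors L e v n g S μ)
    (hG : ∫⁻ x : H, ‖(1 + ‖x‖ ^ k : ℝ)‖ₑ ^ 4 ∂μ < ∞) : ∫⁻ x, errorBound C k S x ∂μ ≠ ∞ := by
  simp only [errorBound]
  rw [lintegral_const_mul' _ _ (by simp), lintegral_add_right _ hD.measurable]
  refine ENNReal.mul_ne_top (by simp) (ENNReal.add_ne_top.2 ⟨?_, hD.lintegral_ne_top⟩)
  simp only [enorm_mul (2 * |C|), mul_pow _ ‖(1 + ‖_‖ ^ k : ℝ)‖ₑ]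
  rw [lintegral_const_mul' _ _ (ENNReal.pow_ne_top enorm_ne_top)]
  exact ENNReal.mul_ne_top (ENNReal.pow_ne_top enorm_ne_top) hG.ne

theorem DominatedErrors.enorm_pow_le_errorBound (hD : DominatedErrors L e v n g S μ)
    {E : Type*} [SeminormedAddCommGroup E] {y : E} {m : ℕ} {x : H}
    (h : ‖y‖ ≤ 2 * |C| * (1 + ‖x‖ ^ k) + galerkinError L e v (n m) (g m) x) :
    ‖y‖ₑ ^ 4 ≤ errorBound C k S x :=
  enorm_pow_le_of_norm_le_of_enorm_pow_le (by positivity) (galerkinError_nonneg x) h (hD.le m x)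

namespace DominatedErrors

section Feedback

variable {Ξ Ut : Type*} [NormedAddCommGroup Ξ] [InnerProductSpace ℝ Ξ] [CompleteSpace Ξ]
  [NormedAddCommGroup Ut]
  {U : Set Ut} {c : Coefficients H Ξ U} {Ψ : H → H → (H →L[ℝ] H) → U}

theorem continuous_feedback_sub (hD : DominatedErrors L e v n g S μ) (hc : c.Regular)
    (hU : IsCompact U)
    (hΨ : ∀ (x p : H) (Z : H →L[ℝ] H), IsSelfAdjoint Z → argminFcv c e x p Z = {Ψ x p Z})
    (hv : ContDiff ℝ 2 v) (m : ℕ) :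
    Continuous fun x => feedback Ψ v x - feedback Ψ (fun z => g m (coord e (n m) z)) x :=
  (continuous_feedback hc hU hΨ hv).sub
    (continuous_feedback hc hU hΨ (contDiff_comp_coord e _ (hD.contDiff m)))

end Feedback

variable [BorelSpace H]

theorem tendsto_lintegral_value (hD : DominatedErrors L e v n g S μ) (hv : ContDiff ℝ 2 v)
    (hk : 0 ≤ k) (hC : ∀ x, |v x| ≤ C * (1 + ‖x‖ ^ k))
    (hG : ∫⁻ x : H, ‖(1 + ‖x‖ ^ k : ℝ)‖ₑ ^ 4 ∂μ < ∞) :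
    Tendsto (fun m => ∫⁻ x, ‖v x - g m (coord e (n m) x)‖ₑ ^ 4 ∂μ) atTop (𝓝 0) := by
  refine tendsto_lintegral_enorm_pow_zero four_ne_zero (fun m =>
    ((hv.continuous.sub
      (contDiff_comp_coord e _ (hD.contDiff m)).continuous).enorm.measurable.pow_const
        4).aemeasurable)
    (fun m => ae_of_all _ fun x => hD.enorm_pow_le_errorBound (abs_sub_comp_coord_le hk hC x))
    (lintegral_errorBound_ne_top hD hG) ?_
  filter_upwards [hD.ae_tendsto] with x hx
  have h1 := (tendsto_const_nhds (x := v x)).sub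
    (tendsto_comp_coord hv hD.tendsto_dim (tendsto_const_nhds (x := x)) hx)
  rwa [sub_self] at h1

theorem tendsto_lintegral_gradient (hD : DominatedErrors L e v n g S μ) (hv : ContDiff ℝ 2 v)
    (hk : 0 ≤ k) (hC : ∀ x, ‖gradient v x‖ ≤ C * (1 + ‖x‖ ^ k))
    (hG : ∫⁻ x : H, ‖(1 + ‖x‖ ^ k : ℝ)‖ₑ ^ 4 ∂μ < ∞) :
    Tendsto (fun m => ∫⁻ x, ‖gradient v x - gradient (fun z => g m (coord e (n m) z)) x‖ₑ ^ 4 ∂μ)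
      atTop (𝓝 0) := by
  refine tendsto_lintegral_enorm_pow_zero four_ne_zero (fun m =>
    (((continuous_gradient hv).sub (continuous_gradient
      (contDiff_comp_coord e _ (hD.contDiff m)))).enorm.measurable.pow_const 4).aemeasurable)
    (fun m => ae_of_all _ fun x => hD.enorm_pow_le_errorBound
      (norm_gradient_sub_comp_coord_le hv (hD.contDiff m) hk hC x))
    (lintegral_errorBound_ne_top hD hG) ?_
  filter_upwards [hD.ae_tendsto] with x hx
  have h1 := (tendsto_const_nhds (x := gradient v x)).sub
    (tendsto_gradient_comp_coord hv hD.contDiff hD.tendsto_dim (tendsto_const_nhds (x := x)) hx)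
  rwa [sub_self] at h1

/-- Only `D²v(x) h` converges for each `h`, hence the product measure. The majorant is a function of
`x` times `‖h‖⁴`, and its integral factorises. -/
theorem tendsto_lintegral_hess [SecondCountableTopology H] [SFinite μ']
    (hD : DominatedErrors L e v n g S μ) (hv : ContDiff ℝ 2 v)
    (hk : 0 ≤ k) (hC : ∀ x, ‖hess v x‖ ≤ C * (1 + ‖x‖ ^ k))
    (hG : ∫⁻ x : H, ‖(1 + ‖x‖ ^ k : ℝ)‖ₑ ^ 4 ∂μ < ∞) (hμ' : ∫⁻ h, ‖h‖ₑ ^ 4 ∂μ' < ∞) :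
    Tendsto (fun m => ∫⁻ z, ‖(hess v z.1 - hess (fun x => g m (coord e (n m) x)) z.1) z.2‖ₑ ^ 4
      ∂(μ.prod μ')) atTop (𝓝 0) := by
  refine tendsto_lintegral_enorm_pow_zero (bound := fun z => errorBound C k S z.1 * ‖z.2‖ₑ ^ 4)
    four_ne_zero (fun m => ?_) (fun m => ae_of_all _ fun z => ?_) ?_ ?_
  · exact (((((continuous_hess hv).sub (continuous_hess
      (contDiff_comp_coord e _ (hD.contDiff m)))).comp continuous_fst).clm_apply
        continuous_snd).enorm.measurable.pow_const 4).aemeasurable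
  · calc _ ≤ (‖hess v z.1 - hess (fun x => g m (coord e (n m) x)) z.1‖ₑ * ‖z.2‖ₑ) ^ 4 := by
          gcongr; exact ContinuousLinearMap.le_opENorm _ _
      _ = ‖hess v z.1 - hess (fun x => g m (coord e (n m) x)) z.1‖ₑ ^ 4 * ‖z.2‖ₑ ^ 4 :=
          mul_pow _ _ _
      _ ≤ _ := by
          gcongr
          exact hD.enorm_pow_le_errorBound
            (norm_hess_sub_comp_coord_le hv (hD.contDiff m) hk hC z.1)
  · rw [lintegral_prod_mul (measurable_errorBound hD.measurable).aemeasurable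
      (measurable_enorm.pow_const 4).aemeasurable]
    exact ENNReal.mul_ne_top (lintegral_errorBound_ne_top hD hG) hμ'.ne
  · filter_upwards [Measure.quasiMeasurePreserving_fst.ae hD.ae_tendsto] with z hz
    have h1 := (tendsto_const_nhds (x := hess v z.1 z.2)).sub
      (tendsto_hess_comp_coord hv hD.contDiff hD.tendsto_dim (tendsto_const_nhds (x := z.1)) hz z.2)
    rw [sub_self] at h1
    exact h1

theorem tendsto_lintegral_inner (hD : DominatedErrors L e v n g S μ) (hv : ContDiff ℝ 2 v)
    (he : ∀ i, e i ∈ L.domain) (hdom : ∀ x, gradient v x ∈ L.domain) (hk : 1 ≤ k)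
    (hG : ∫⁻ x : H, ‖(1 + ‖x‖ ^ k : ℝ)‖ₑ ^ 4 ∂μ < ∞)
    (hcons : Tendsto (fun d => ∫⁻ x, ‖consistencyError L e v d x‖ₑ ^ 2 ∂μ) atTop (𝓝 0)) :
    Tendsto (fun m => ∫⁻ x, ‖⟪opApply L (gradient v x
      - gradient (fun z => g m (coord e (n m) z)) x), x⟫‖ₑ ^ 2 ∂μ) atTop (𝓝 0) := by
  have hmeas : ∀ m, AEMeasurable
      (fun x => ‖galerkinError L e v (n m) (g m) x * ‖x‖‖ₑ ^ 2) μ := fun m =>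
    (((continuous_galerkinError hv (hD.contDiff m)).mul
      continuous_norm).enorm.measurable.pow_const 2).aemeasurable
  refine tendsto_lintegral_enorm_pow_zero_of_le 2
    (fun m x => (abs_inner_opApply_gradient_sub_le hv (hD.contDiff m) he (hdom x)).trans
      (add_le_add le_rfl (le_abs_self _)))
    hmeas (hcons.comp hD.tendsto_dim) ?_
  -- As `k ≥ 1`, the factor `‖x‖` is at most `1 + ‖x‖ ^ k`, which is in `L⁴(μ)`.
  refine tendsto_lintegral_enorm_pow_zero
    (bound := fun x => S x + ‖(1 + ‖x‖ ^ k : ℝ)‖ₑ ^ 4) two_ne_zero hmeas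
    (fun m => ae_of_all _ fun x => ?_) ?_ ?_
  · rw [enorm_mul, enorm_norm]
    refine (mul_pow_two_le_pow_four_add _ _).trans (add_le_add (hD.le m x) ?_)
    gcongr
    rw [← ofReal_norm, Real.enorm_of_nonneg (by positivity)]
    exact ENNReal.ofReal_le_ofReal (norm_le_one_add_rpow hk x)
  · rw [lintegral_add_left hD.measurable]
    exact ENNReal.add_ne_top.2 ⟨hD.lintegral_ne_top, hG.ne⟩
  · filter_upwards [hD.ae_tendsto] with x hx
    simpa using hx.mul_const ‖x‖

section Control

variable {Ξ Ut : Type*} [NormedAddCommGroup Ξ] [InnerProductSpace ℝ Ξ] [CompleteSpace Ξ]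
  [NormedAddCommGroup Ut]
  {U : Set Ut} {c : Coefficients H Ξ U} {Ψ : H → H → (H →L[ℝ] H) → U} {γ : ℝ}

theorem tendsto_lintegral_hamiltonian (hD : DominatedErrors L e v n g S μ) (hc : c.Regular)
    (hU : IsCompact U)
    (hΨ : ∀ (x p : H) (Z : H →L[ℝ] H), IsSelfAdjoint Z → argminFcv c e x p Z = {Ψ x p Z})
    (hlip : GrowthLipschitz (hamiltonian c e γ) k) (hv : ContDiff ℝ 2 v) (hk : 0 ≤ k)
    (hC : ∀ x, |v x| + ‖gradient v x‖ + ‖hess v x‖ ≤ C * (1 + ‖x‖ ^ k))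
    (hG : ∫⁻ x : H, ‖(1 + ‖x‖ ^ k : ℝ)‖ₑ ^ 4 ∂μ < ∞) :
    Tendsto (fun m => ∫⁻ x, ‖hamiltonian c e γ x (g m (coord e (n m) x))
        (gradient (fun z => g m (coord e (n m) z)) x) (hess (fun z => g m (coord e (n m) z)) x)
      - hamiltonian c e γ x (v x) (gradient v x) (hess v x)‖ₑ ^ 2 ∂μ) atTop (𝓝 0) := by
  obtain ⟨C', hC'⟩ := hlip
  have hw := fun m => contDiff_comp_coord e _ (hD.contDiff m)
  refine tendsto_lintegral_enorm_pow_zero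
    (bound := fun x => ‖|C'| * 3‖ₑ ^ 2 * (errorBound C k S x + ‖(1 + ‖x‖ ^ k : ℝ)‖ₑ ^ 4))
    two_ne_zero
    (fun m => (((continuous_hamiltonian_comp hc hU hΨ γ (hw m)).sub
      (continuous_hamiltonian_comp hc hU hΨ γ hv)).enorm.measurable.pow_const 2).aemeasurable)
    (fun m => ae_of_all _ fun x => ?_) ?_ ?_
  · have hG0 : 0 ≤ 1 + ‖x‖ ^ k := by positivity
    have b1 := abs_sub_comp_coord_le (L := L) (e := e) (v := v) (g := g m) (C := C) hk
      (fun x => by linarith [hC x, norm_nonneg (gradient v x), norm_nonneg (hess v x)]) x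
    have b2 := norm_gradient_sub_comp_coord_le (L := L) (e := e) (C := C) hv (hD.contDiff m) hk
      (fun x => by linarith [hC x, abs_nonneg (v x), norm_nonneg (hess v x)]) x
    have b3 := norm_hess_sub_comp_coord_le (L := L) (e := e) (C := C) hv (hD.contDiff m) hk
      (fun x => by linarith [hC x, abs_nonneg (v x), norm_nonneg (gradient v x)]) x
    have h2 := hC' x (v x) (g m (coord e (n m) x)) (gradient v x)
      (gradient (fun z => g m (coord e (n m) z)) x) (hess v x)
      (hess (fun z => g m (coord e (n m) z)) x)
      (isSelfAdjoint_hess hv x) (isSelfAdjoint_hess (hw m) x)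
    have ha0 : 0 ≤ 2 * |C| * (1 + ‖x‖ ^ k) + galerkinError L e v (n m) (g m) x :=
      add_nonneg (by positivity) (galerkinError_nonneg x)
    have hB : ‖2 * |C| * (1 + ‖x‖ ^ k) + galerkinError L e v (n m) (g m) x‖ₑ ^ 4
        ≤ errorBound C k S x :=
      hD.enorm_pow_le_errorBound (by rw [Real.norm_of_nonneg ha0])
    -- One quantity `a` bounds the errors of the value, the gradient and the Hessian, so the
    -- Lipschitz estimate yields the factor 3.
    generalize 2 * |C| * (1 + ‖x‖ ^ k) + galerkinError L e v (n m) (g m) x = a at *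
    have h3 : _ ≤ |C'| * 3 * (a * (1 + ‖x‖ ^ k)) := h2.trans <|
      calc _ ≤ |C'| * (a + a + a) * (1 + ‖x‖ ^ k) := by
            gcongr
            exact le_abs_self C'
        _ = _ := by ring
    calc _ ≤ ‖|C'| * 3 * (a * (1 + ‖x‖ ^ k))‖ₑ ^ 2 := by
          gcongr
          rw [← ofReal_norm, Real.enorm_of_nonneg (by positivity), norm_sub_rev]
          exact ENNReal.ofReal_le_ofReal h3
      _ = ‖|C'| * 3‖ₑ ^ 2 * (‖a‖ₑ * ‖(1 + ‖x‖ ^ k : ℝ)‖ₑ) ^ 2 := by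
          rw [enorm_mul _ (a * _), enorm_mul a, mul_pow]
      _ ≤ _ := by
          gcongr
          refine (mul_pow_two_le_pow_four_add _ _).trans ?_
          gcongr
  · rw [lintegral_const_mul' _ _ (ENNReal.pow_ne_top enorm_ne_top),
      lintegral_add_left (measurable_errorBound hD.measurable)]
    exact ENNReal.mul_ne_top (ENNReal.pow_ne_top enorm_ne_top)
      (ENNReal.add_ne_top.2 ⟨lintegral_errorBound_ne_top hD hG, hG.ne⟩)
  · filter_upwards [hD.ae_tendsto] with x hx
    exact tendsto_hamiltonian_sub hc hU hΨ γ hv hD.contDiff hD.tendsto_dim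
      (tendsto_const_nhds (x := x)) hx

theorem tendsto_lintegral_residual (hD : DominatedErrors L e v n g S μ) (hc : c.Regular)
    (hU : IsCompact U)
    (hΨ : ∀ (x p : H) (Z : H →L[ℝ] H), IsSelfAdjoint Z → argminFcv c e x p Z = {Ψ x p Z})
    (hlip : GrowthLipschitz (hamiltonian c e γ) k)
    (hv : IsClassicalSolution L (hamiltonian c e γ) v) (he : ∀ i, e i ∈ L.domain) (hk : 1 ≤ k)
    (hC : ∀ x, |v x| + ‖gradient v x‖ + ‖hess v x‖ ≤ C * (1 + ‖x‖ ^ k))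
    (hG : ∫⁻ x : H, ‖(1 + ‖x‖ ^ k : ℝ)‖ₑ ^ 4 ∂μ < ∞)
    (hcons : Tendsto (fun d => ∫⁻ x, ‖consistencyError L e v d x‖ₑ ^ 2 ∂μ) atTop (𝓝 0)) :
    Tendsto (fun m => ∫⁻ x, ‖residual L (hamiltonian c e γ) (fun z => g m (coord e (n m) z)) x‖ₑ ^ 2
      ∂μ) atTop (𝓝 0) := by
  refine tendsto_lintegral_enorm_pow_zero_of_le 2 (fun m x => ?_) (fun m => ?_)
    (hD.tendsto_lintegral_inner hv.contDiff he hv.mem_domain hk hG hcons)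
    (hD.tendsto_lintegral_hamiltonian hc hU hΨ hlip hv.contDiff (zero_le_one.trans hk) hC hG)
  · rw [residual_comp_coord_eq hv he (hD.contDiff m) x, norm_sub_rev]
    exact norm_sub_le _ _
  · exact (((continuous_hamiltonian_comp hc hU hΨ γ
      (contDiff_comp_coord e _ (hD.contDiff m))).sub
      (continuous_hamiltonian_comp hc hU hΨ γ hv.contDiff)).enorm.measurable.pow_const
        2).aemeasurable

theorem memLp_feedback [IsFiniteMeasure μ] [SecondCountableTopology H]
    (hD : DominatedErrors L e v n g S μ) (hc : c.Regular) (hU : IsCompact U)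
    (hΨ : ∀ (x p : H) (Z : H →L[ℝ] H), IsSelfAdjoint Z → argminFcv c e x p Z = {Ψ x p Z})
    (hv : ContDiff ℝ 2 v) (m : ℕ) (p : ℝ≥0∞) :
    MemLp (fun x => feedback Ψ v x - feedback Ψ (fun z => g m (coord e (n m) z)) x) p μ := by
  obtain ⟨R, hR⟩ := hU.isBounded.exists_norm_le
  exact MemLp.of_bound (hD.continuous_feedback_sub hc hU hΨ hv m).aestronglyMeasurable (R + R)
    (ae_of_all _ fun x => (norm_sub_le _ _).trans
      (add_le_add (hR _ (Subtype.coe_prop _)) (hR _ (Subtype.coe_prop _))))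

/-- Feedbacks take values in the bounded set `U`, so a constant dominates and no growth condition is
needed. -/
theorem tendsto_eLpNorm_feedback [IsFiniteMeasure μ]
    (hD : DominatedErrors L e v n g S μ) (hc : c.Regular) (hU : IsCompact U)
    (hΨ : ∀ (x p : H) (Z : H →L[ℝ] H), IsSelfAdjoint Z → argminFcv c e x p Z = {Ψ x p Z})
    (hv : ContDiff ℝ 2 v) :
    Tendsto (fun m => eLpNorm (fun x => feedback Ψ v x
      - feedback Ψ (fun z => g m (coord e (n m) z)) x) 2 μ ^ 2) atTop (𝓝 0) := by
  obtain ⟨R, hR⟩ := hU.isBounded.exists_norm_le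
  have h : Tendsto (fun m => ∫⁻ x, ‖feedback Ψ v x
      - feedback Ψ (fun z => g m (coord e (n m) z)) x‖ₑ ^ 2 ∂μ) atTop (𝓝 0) := by
    refine tendsto_lintegral_enorm_pow_zero (bound := fun _ => ENNReal.ofReal (R + R) ^ 2)
      two_ne_zero (fun m => ((hD.continuous_feedback_sub hc hU hΨ
        hv m).enorm.measurable.pow_const 2).aemeasurable) (fun m => ae_of_all _ fun x => ?_) ?_ ?_
    · gcongr
      rw [← ofReal_norm]
      exact ENNReal.ofReal_le_ofReal ((norm_sub_le _ _).trans
        (add_le_add (hR _ (Subtype.coe_prop _)) (hR _ (Subtype.coe_prop _))))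
    · rw [lintegral_const]
      exact ENNReal.mul_ne_top (by simp) (measure_ne_top _ _)
    · filter_upwards [hD.ae_tendsto] with x hx
      exact tendsto_feedback_sub hc hU hΨ hv hD.contDiff hD.tendsto_dim
        (tendsto_const_nhds (x := x)) hx
  refine h.congr fun m => ?_
  have h8 := eLpNorm_nnreal_pow_eq_lintegral (μ := μ) (p := 2) two_ne_zero
    (f := fun x => feedback Ψ v x - feedback Ψ (fun z => g m (coord e (n m) z)) x)
  simp only [NNReal.coe_ofNat, ENNReal.rpow_ofNat, ENNReal.coe_ofNat] at h8
  exact h8.symm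

end Control

end DominatedErrors

theorem exists_dominatedErrors [BorelSpace H] [IsFiniteMeasure μ] {Θ : ℕ → Type*}
    {f : ∀ d, Θ d → EuclideanSpace ℝ (Fin d) → ℝ}
    (hf : ∀ d θ, ContDiff ℝ 2 (f d θ)) (huniv : UniversalInSobolev 4 f)
    (hv : ContDiff ℝ 2 v) (hk : 0 ≤ k)
    (hC : ∀ x, |v x| + ‖gradient v x‖ + ‖hess v x‖ ≤ C * (1 + ‖x‖ ^ k))
    (hG : ∫⁻ x : H, ‖(1 + ‖x‖ ^ k : ℝ)‖ₑ ^ 4 ∂μ < ∞) :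
    ∃ (θ : ∀ m, Θ (m + 1)) (S : H → ℝ≥0∞),
      DominatedErrors L e v (fun m => m + 1) (fun m => f (m + 1) (θ m)) S μ := by
  -- The geometric tolerances make the integrals summable; the series of fourth powers is then the
  -- integrable majorant `S`.
  choose θ hθ using fun m : ℕ => exists_lintegral_galerkinError_lt (L := L) (e := e) hf huniv
    (Nat.le_add_left 1 m) hv hk hC hG (δ := (1 / 2) ^ m) (by positivity)
  have hmeas : ∀ m, Measurable fun x => ‖galerkinError L e v (m + 1) (f (m + 1) (θ m)) x‖ₑ ^ 4 :=
    fun m => (continuous_galerkinError hv (hf _ _)).enorm.measurable.pow_const 4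
  have hsum : ∑' m, ∫⁻ x, ‖galerkinError L e v (m + 1) (f (m + 1) (θ m)) x‖ₑ ^ 4 ∂μ ≠ ∞ := by
    refine ne_top_of_le_ne_top ?_ (ENNReal.tsum_le_tsum hθ)
    rw [← ENNReal.ofReal_tsum_of_nonneg (fun m => by positivity) summable_geometric_two]
    exact ENNReal.ofReal_ne_top
  obtain ⟨hS, hae⟩ := ae_tendsto_zero_of_tsum_lintegral_ne_top four_ne_zero
    (fun m => (hmeas m).aemeasurable) hsum
  exact ⟨θ, _, fun m => hf _ _, tendsto_add_atTop_nat 1, Measurable.tsum hmeas, hS,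
    fun m x => ENNReal.le_tsum m, hae⟩

end MeanConvergence

end HilbertHJB

end

theorem mainTheorem5
    {H Ξ Ut : Type*}
    [NormedAddCommGroup H] [InnerProductSpace ℝ H] [CompleteSpace H]
    [TopologicalSpace.SeparableSpace H] [MeasurableSpace H] [BorelSpace H]
    [NormedAddCommGroup Ξ] [InnerProductSpace ℝ Ξ] [CompleteSpace Ξ]
    [TopologicalSpace.SeparableSpace Ξ]
    [NormedAddCommGroup Ut] [InnerProductSpace ℝ Ut] [CompleteSpace Ut]
    [TopologicalSpace.SeparableSpace Ut]
    -- the control problem and its HJB equation, with `L = A*`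
    (A : H →ₗ.[ℝ] H) (hA : HilbertHJB.GeneratesC0Semigroup A)
    (U : Set Ut) (hU : IsCompact U)
    (c : HilbertHJB.Coefficients H Ξ U) (hc : c.Regular)
    (γ : ℝ) (hγ : 0 < γ)
    (e : HilbertBasis ℕ ℝ H) (he : ∀ i, e i ∈ A.adjoint.domain)
    (v : H → ℝ)
    (hv : HilbertHJB.IsClassicalSolution A.adjoint (HilbertHJB.hamiltonian c e γ) v)
    -- the argmin map is single-valued
    (Ψ : H → H → (H →L[ℝ] H) → U)
    (hΨ : ∀ (x p : H) (Z : H →L[ℝ] H), IsSelfAdjoint Z →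
      HilbertHJB.argminFcv c e x p Z = {Ψ x p Z})
    -- the trainable family
    {Θ : ℕ → Type*} (f : ∀ d, Θ d → EuclideanSpace ℝ (Fin d) → ℝ)
    (hf : ∀ d θ, ContDiff ℝ 2 (f d θ)) :
    -- (i) uniform approximation on compact sets
    (HilbertHJB.UniversalOnCompacts f →
      ∀ K K' : Set H, IsCompact K → IsCompact K' →
      TendstoUniformlyOn (HilbertHJB.consistencyError A.adjoint e v) 0 atTop K →
      ∀ ε : ℝ, 0 < ε → ∃ d : ℕ, 1 ≤ d ∧ ∃ θ : Θ d,
        (∀ x, gradient (HilbertHJB.hgno e f d θ) x ∈ A.adjoint.domain) ∧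
        (∀ x ∈ K, |v x - HilbertHJB.hgno e f d θ x| < ε) ∧
        (∀ x ∈ K, ‖gradient v x - gradient (HilbertHJB.hgno e f d θ) x‖ < ε) ∧
        (∀ x ∈ K, ∀ h ∈ K',
          ‖(HilbertHJB.hess v x - HilbertHJB.hess (HilbertHJB.hgno e f d θ) x) h‖ < ε) ∧
        (∀ x ∈ K, |⟪HilbertHJB.opApply A.adjoint
          (gradient v x - gradient (HilbertHJB.hgno e f d θ) x), x⟫| < ε) ∧
        (∀ x ∈ K, |HilbertHJB.residual A.adjoint (HilbertHJB.hamiltonian c e γ)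
          (HilbertHJB.hgno e f d θ) x| < ε) ∧
        (∀ x ∈ K, ‖HilbertHJB.feedback Ψ v x
          - HilbertHJB.feedback Ψ (HilbertHJB.hgno e f d θ) x‖ < ε)) ∧
    -- (ii) approximation in the mean
    (HilbertHJB.UniversalInSobolev 4 f →
      ∀ k : ℝ, 1 ≤ k →
      (2 ≤ k ∨ HilbertHJB.GrowthLipschitz (HilbertHJB.hamiltonian c e γ) k) →
      (∃ C : ℝ, ∀ x, |v x| + ‖gradient v x‖ + ‖HilbertHJB.hess v x‖ ≤ C * (1 + ‖x‖ ^ k)) →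
      ∀ μ μ' : Measure H, IsProbabilityMeasure μ → IsProbabilityMeasure μ' →
      ∫⁻ x, ‖x‖ₑ ^ (4 * k) ∂μ < ∞ →
      ∫⁻ h, ‖h‖ₑ ^ 4 ∂μ' < ∞ →
      Tendsto (fun d => ∫⁻ x, ‖HilbertHJB.consistencyError A.adjoint e v d x‖ₑ ^ 2 ∂μ)
        atTop (𝓝 0) →
      ∀ ε : ℝ, 0 < ε → ∃ d : ℕ, 1 ≤ d ∧ ∃ θ : Θ d,
        (∀ x, gradient (HilbertHJB.hgno e f d θ) x ∈ A.adjoint.domain) ∧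
        ∫⁻ x, ‖v x - HilbertHJB.hgno e f d θ x‖ₑ ^ 4 ∂μ < ENNReal.ofReal ε ∧
        ∫⁻ x, ‖gradient v x - gradient (HilbertHJB.hgno e f d θ) x‖ₑ ^ 4 ∂μ
          < ENNReal.ofReal ε ∧
        ∫⁻ z, ‖(HilbertHJB.hess v z.1 - HilbertHJB.hess (HilbertHJB.hgno e f d θ) z.1) z.2‖ₑ ^ 4
          ∂(μ.prod μ') < ENNReal.ofReal ε ∧
        ∫⁻ x, ‖⟪HilbertHJB.opApply A.adjoint
          (gradient v x - gradient (HilbertHJB.hgno e f d θ) x), x⟫‖ₑ ^ 2 ∂μ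
          < ENNReal.ofReal ε ∧
        ∫⁻ x, ‖HilbertHJB.residual A.adjoint (HilbertHJB.hamiltonian c e γ)
          (HilbertHJB.hgno e f d θ) x‖ₑ ^ 2 ∂μ < ENNReal.ofReal ε ∧
        MemLp (fun x => HilbertHJB.feedback Ψ v x
          - HilbertHJB.feedback Ψ (HilbertHJB.hgno e f d θ) x) 2 μ ∧
        eLpNorm (fun x => HilbertHJB.feedback Ψ v x
          - HilbertHJB.feedback Ψ (HilbertHJB.hgno e f d θ) x) 2 μ ^ 2 < ENNReal.ofReal ε) := by
  have : SecondCountableTopology H := UniformSpace.secondCountable_of_separable H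
  refine ⟨fun huniv K K' hK hK' hcons ε hε =>
    HilbertHJB.exists_approximation_on_compacts hc hU hΨ he hv hf huniv hK hK' hcons hε, ?_⟩
  intro huniv k hk hlip hgrowth μ μ' _ _ hμ hμ' hcons ε hε
  have hlip : HilbertHJB.GrowthLipschitz (HilbertHJB.hamiltonian c e γ) k :=
    hlip.elim (HilbertHJB.growthLipschitz_of_two_le hc hΨ γ) id
  obtain ⟨C, hC⟩ := hgrowth
  have hk0 : 0 ≤ k := zero_le_one.trans hk
  have hv2 := hv.contDiff
  have hG := HilbertHJB.lintegral_one_add_rpow_pow_four_lt_top hk0 hμ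
  obtain ⟨θ, S, hD⟩ := HilbertHJB.exists_dominatedErrors (L := A.adjoint) (e := e) hf huniv hv2
    hk0 hC hG
  have t1 := hD.tendsto_lintegral_value (C := C) hv2 hk0 (fun x => by
    linarith [hC x, norm_nonneg (gradient v x), norm_nonneg (HilbertHJB.hess v x)]) hG
  have t2 := hD.tendsto_lintegral_gradient (C := C) hv2 hk0 (fun x => by
    linarith [hC x, abs_nonneg (v x), norm_nonneg (HilbertHJB.hess v x)]) hG
  have t3 := hD.tendsto_lintegral_hess (C := C) hv2 hk0 (fun x => by
    linarith [hC x, abs_nonneg (v x), norm_nonneg (gradient v x)]) hG hμ'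
  have t4 := hD.tendsto_lintegral_inner hv2 he hv.mem_domain hk hG hcons
  have t5 := hD.tendsto_lintegral_residual hc hU hΨ hlip hv he hk hC hG hcons
  have t6 := hD.tendsto_eLpNorm_feedback hc hU hΨ hv2
  have hε' : 0 < ENNReal.ofReal ε := ENNReal.ofReal_pos.2 hε
  obtain ⟨m, h1, h2, h3, h4, h5, h6⟩ := ((t1.eventually_lt_const hε').and
    ((t2.eventually_lt_const hε').and ((t3.eventually_lt_const hε').and
    ((t4.eventually_lt_const hε').and ((t5.eventually_lt_const hε').and
    (t6.eventually_lt_const hε')))))).exists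
  exact ⟨m + 1, Nat.le_add_left 1 m, θ m,
    HilbertHJB.gradient_comp_coord_mem_domain he (hD.contDiff m), h1, h2, h3, h4, h5,
    hD.memLp_feedback hc hU hΨ hv2 m 2, h6⟩
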